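/- Let $(\Omega,\mathbb F,\mathbb P)$ be a probability space. Market. Let $r$ be a real-valued process that is almost surely integrable on bounded time intervals, let $S_0(t)=s_0e^{\int_0^t r(v)\,dv}$ with $s_0>0$, let $S_1$ be a real-valued process, $S=(S_0,S_1)$ (a measurable random vector at each time), and let $\mathcal F^S$ be the natural filtration of $S$. Insured. Let $Z$ be a non-explosive jump process on a finite state space $\mathcal J$ with $Z(0)\equiv z_0\in\mathcal J$, with natural filtration $\mathcal F^Z$. Assume that $Z$ is independent of $S$ and is Markovian with transition probabilities $p_{ij}(s,t)$ and non-negative, locally integrable transition rates $\mu_{jk}$, $j\neq k$ (that is, $\mathbb P(Z(t)=j\mid\mathcal F^Z(s))=p_{Z(s)j}(s,t)$ and Kolmogorov's forward equations hold in integrated form). Put $N_{jk}(t)=\#\{s\in(0,t]: Z(s-)=j,\ Z(s)=k\}$ and $\mathcal F=\mathcal F^S\vee\mathcal F^Z$. Payments. Let $b_j^\dagger$ and $b_{jk}^\dagger$ ($j\ne k$) be non-negative measurable deterministic functions on $[0,\infty)$. The unit bonus payment stream is $$dB^\dagger(t)=\sum_{j\in\mathcal J}\mathbf 1_{(Z(t-)=j)}\Big(b_j^\dagger(t)\,dt+\sum_{k\neq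 j}b_{jk}^\dagger(t)\,dN_{jk}(t)\Big),\qquad B^\dagger(0)=0.$$ Let $n\in(0,\infty)$ be the maximal contract time, and let $Q$, the number of unit bonus payment streams held, be an $\mathcal F$-adapted real-valued process with almost surely continuous paths, $\mathbb E|Q(t)|<\infty$ for all $t\ge0$, and $\mathbb E\big[\int_0^n e^{-\int_0^t r(v)\,dv}|Q(t)|\,dB^\dagger(t)\big]<\infty$. The time-zero market value of bonus payments is $$V^b(0)=\mathbb E\Big[\int_0^n e^{-\int_0^t r(v)\,dv}\,Q(t)\,dB^\dagger(t)\Big].$$ For $j\in\mathcal J$ and $t\ge 0$ let $p^Q_{z_0j}(0,t)=\mathbb E\big[Q(t)\mathbf 1_{(Z(t)=j)}\mid\mathcal F^S(t)\big]$ be the $Q$-modified transition probabilities, taken in a version that is jointly measurable in $(t,\omega)$, and put $$a^b(0,t)=\sum_{j\in\mathcal J}p^Q_{z_0j}(0,t)\Big(b^\dagger_j(t)+\sum_{k\ne j}b^\dagger_{jk}(t)\mu_{jk}(t)\Big),\qquad a^\dagger(0,t)=\sum_{j\in\mathcal J}p_{z_0j}(0,t)\Big(b^\dagger_j(t)+\sum_{k\ne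 j}b^\dagger_{jk}(t)\mu_{jk}(t)\Big).$$ Proposition. A jointly measurable version of $p^Q_{z_0j}(0,\cdot)$, $j\in\mathcal J$, exists. For every such version, the random variable $\int_0^n e^{-\int_0^t r(v)\,dv}Q(t)\,dB^\dagger(t)$ is $\mathbb P$-integrable, $(\omega,t)\mapsto e^{-\int_0^t r(v)\,dv}a^b(0,t)$ is integrable with respect to $\mathbb P\otimes dt$ on $\Omega\times(0,n]$, and, with $A^b(0,dt)=a^b(0,t)\,dt$, $$V^b(0)=\mathbb E\Big[\int_0^n e^{-\int_0^t r(v)\,dv}A^b(0,dt)\Big]=\mathbb E\Big[\int_0^n e^{-\int_0^t r(v)\,dv}a^b(0,t)\,dt\Big].$$ Furthermore, if $Q$ is adapted to $\mathcal F^S$, then for every $t\ge0$ and $j\in\mathcal J$, almost surely, $$p^Q_{z_0j}(0,t)=Q(t)\,p_{z_0j}(0,t),\qquad a^b(0,t)=Q(t)\,a^\dagger(0,t).$$ -/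

import Mathlib

open MeasureTheory ProbabilityTheory Set Filter
open scoped Topology ENNReal NNReal

noncomputable section

namespace LifeBonus

/-- The information generated by a process `X` on the time interval `[0, t]`. -/
abbrev history {Ω β : Type*} [MeasurableSpace β] (X : ℝ → Ω → β) (t : ℝ) : MeasurableSpace Ω :=
  ⨆ u ∈ Icc (0 : ℝ) t, MeasurableSpace.comap (X u) inferInstance

/-- The information generated by the whole path of a process `X` on `[0, ∞)`. -/
abbrev fullHistory {Ω β : Type*} [MeasurableSpace β] (X : ℝ → Ω → β) : MeasurableSpace Ω :=
  ⨆ u ∈ Ici (0 : ℝ), MeasurableSpace.comap (X u) inferInstance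

/-! ### Financial market -/

/-- The bank account `S₀(t) = s₀ exp (∫₀ᵗ r(v) dv)`. -/
def bankAccount {Ω : Type*} (s₀ : ℝ) (r : ℝ → Ω → ℝ) (t : ℝ) (ω : Ω) : ℝ :=
  s₀ * Real.exp (∫ v in (0 : ℝ)..t, r v ω)

/-- The market `S = (S₀, S₁)`. -/
def market {Ω : Type*} (s₀ : ℝ) (r : ℝ → Ω → ℝ) (S₁ : ℝ → Ω → ℝ) (t : ℝ) (ω : Ω) : ℝ × ℝ :=
  (bankAccount s₀ r t ω, S₁ t ω)

/-- The discount factor `exp (-∫₀ᵗ r(v) dv)`. -/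
def discount {Ω : Type*} (r : ℝ → Ω → ℝ) (t : ℝ) (ω : Ω) : ℝ :=
  Real.exp (-∫ v in (0 : ℝ)..t, r v ω)

/-! ### State of the insured -/

/-- `Z(t-) = j` on the path `ω`. -/
def LeftState {Ω E : Type*} (Z : ℝ → Ω → E) (ω : Ω) (t : ℝ) (j : E) : Prop :=
  ∀ᶠ s in 𝓝[<] t, Z s ω = j

/-- A jump process started in the state `z₀`. For a finite state space, the existence of left
limits and right-continuity in the discrete topology say exactly that the paths are
right-continuous step functions with finitely many jumps in every bounded interval, so that the
process is non-explosive. -/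
structure IsJumpProcess {Ω E : Type*} [MeasurableSpace Ω] [MeasurableSpace E]
    (Z : ℝ → Ω → E) (z₀ : E) : Prop where
  measurable : ∀ t, 0 ≤ t → Measurable (Z t)
  init : ∀ ω, Z 0 ω = z₀
  right_continuous : ∀ ω t, 0 ≤ t → ∀ᶠ s in 𝓝[>] t, Z s ω = Z t ω
  left_limit : ∀ ω t, 0 < t → ∃ j, LeftState Z ω t j

/-- `Z` is Markovian under `P` with transition probabilities `p s t i j` (from state `i` at time
`s` to state `j` at time `t`) and transition rates `μ i j t`, `i ≠ j`. The rates are locally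
integrable and are linked to `p` by Kolmogorov's forward equations, in integrated form. -/
structure IsMarkovWithRates {Ω E : Type*} [MeasurableSpace Ω] [MeasurableSpace E] [Fintype E]
    [DecidableEq E] (P : Measure Ω) (Z : ℝ → Ω → E) (p : ℝ → ℝ → E → E → ℝ)
    (μ : E → E → ℝ → ℝ) : Prop where
  rate_nonneg : ∀ i j, i ≠ j → ∀ t, 0 ≤ t → 0 ≤ μ i j t
  rate_integrable : ∀ i j, i ≠ j → ∀ t, 0 ≤ t → IntervalIntegrable (μ i j) volume 0 t
  prob_nonneg : ∀ s t, 0 ≤ s → s ≤ t → ∀ i j, 0 ≤ p s t i j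
  prob_sum : ∀ s t, 0 ≤ s → s ≤ t → ∀ i, ∑ j, p s t i j = 1
  markov : ∀ s t, 0 ≤ s → s ≤ t → ∀ j,
    P[(Z t ⁻¹' {j}).indicator (fun _ => (1 : ℝ)) | history Z s] =ᵐ[P] fun ω => p s t (Z s ω) j
  forward : ∀ s t, 0 ≤ s → s ≤ t → ∀ i j,
    p s t i j = (if i = j then 1 else 0) +
      ∫ u in s..t, ((∑ l ∈ Finset.univ.erase j, p s u i l * μ l j u) -
        p s u i j * ∑ k ∈ Finset.univ.erase j, μ j k u)

/-- The times of the jumps of `Z` from `j` to `k` on the path `ω`. -/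
def jumpTimes {Ω E : Type*} (Z : ℝ → Ω → E) (ω : Ω) (j k : E) : Set ℝ :=
  {s | 0 < s ∧ LeftState Z ω s j ∧ Z s ω = k}

/-- The counting process `N_{jk}(t) = #{s ∈ (0, t] : Z(s-) = j, Z(s) = k}`. -/
def countingProcess {Ω E : Type*} (Z : ℝ → Ω → E) (j k : E) (t : ℝ) (ω : Ω) : ℕ∞ :=
  (jumpTimes Z ω j k ∩ Ioc 0 t).encard

/-- The measure `dN_{jk}` on the path `ω`: a unit mass at every jump time from `j` to `k`. -/
def jumpMeasure {Ω E : Type*} (Z : ℝ → Ω → E) (ω : Ω) (j k : E) : Measure ℝ :=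
  Measure.sum fun s : jumpTimes Z ω j k => Measure.dirac (s : ℝ)

/-- `dN_{jk}` is the measure with distribution function `N_{jk}`. -/
theorem jumpMeasure_Ioc {Ω E : Type*} (Z : ℝ → Ω → E) (ω : Ω) (j k : E) (t : ℝ) :
    jumpMeasure Z ω j k (Ioc 0 t) = (countingProcess Z j k t ω : ℝ≥0∞) := by
  rw [jumpMeasure, countingProcess, Measure.sum_apply _ measurableSet_Ioc]
  simp only [Measure.dirac_apply' _ measurableSet_Ioc]
  rw [tsum_subtype (jumpTimes Z ω j k) (fun s => (Ioc 0 t).indicator (1 : ℝ → ℝ≥0∞) s),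
    Set.indicator_indicator]
  have := ENNReal.tsum_set_one (jumpTimes Z ω j k ∩ Ioc 0 t)
  rw [← this, tsum_subtype (jumpTimes Z ω j k ∩ Ioc 0 t) (fun _ => (1 : ℝ≥0∞))]
  rfl

/-! ### Bonus payments -/

/-- The unit bonus payment stream on the path `ω`, as a measure on `(0, ∞)`:
`dB†(t) = ∑_j 1_{Z(t-) = j} (b_j(t) dt + ∑_{k ≠ j} b_{jk}(t) dN_{jk}(t))`, with sojourn payment
rates `b j` and transition payments `c j k`; only used for non-negative `b` and `c`. -/
def unitBonus {Ω E : Type*} [Fintype E] [DecidableEq E] (Z : ℝ → Ω → E) (b : E → ℝ → ℝ)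
    (c : E → E → ℝ → ℝ) (ω : Ω) : Measure ℝ :=
  ∑ j, ((volume.restrict (Ioi 0)).withDensity
      ({t | LeftState Z ω t j}.indicator fun t => ENNReal.ofReal (b j t)) +
    ∑ k ∈ Finset.univ.erase j, (jumpMeasure Z ω j k).withDensity
      ({t | LeftState Z ω t j}.indicator fun t => ENNReal.ofReal (c j k t)))

/-- The time-zero market value of bonus payments,
`V^b(0) = E[∫₀ⁿ exp (-∫₀ᵗ r(v) dv) Q(t) dB†(t)]`. -/
def bonusValue {Ω E : Type*} [MeasurableSpace Ω] [Fintype E] [DecidableEq E] (P : Measure Ω)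
    (r : ℝ → Ω → ℝ) (Z : ℝ → Ω → E) (b : E → ℝ → ℝ) (c : E → E → ℝ → ℝ) (Q : ℝ → Ω → ℝ)
    (n : ℝ) : ℝ :=
  ∫ ω, ∫ t in Ioc 0 n, discount r t ω * Q t ω ∂(unitBonus Z b c ω) ∂P

/-- The expected unit bonus rate in state `j`: `b_j(t) + ∑_{k ≠ j} b_{jk}(t) μ_{jk}(t)`. -/
def stateRate {E : Type*} [Fintype E] [DecidableEq E] (μ : E → E → ℝ → ℝ) (b : E → ℝ → ℝ)
    (c : E → E → ℝ → ℝ) (j : E) (t : ℝ) : ℝ :=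
  b j t + ∑ k ∈ Finset.univ.erase j, c j k t * μ j k t

/-- The expected unit bonus cash flow rate `a†_i(s, t)` given state `i` at time `s`. -/
def unitCashFlow {E : Type*} [Fintype E] [DecidableEq E] (p : ℝ → ℝ → E → E → ℝ)
    (μ : E → E → ℝ → ℝ) (b : E → ℝ → ℝ) (c : E → E → ℝ → ℝ) (i : E) (s t : ℝ) : ℝ :=
  ∑ j, p s t i j * stateRate μ b c j t

/-- `pQ j t` is the `Q`-modified transition probability `E[Q(t) 1_{Z(t) = j} | G(t)]`, in a version
that is jointly measurable in time and scenario (versions chosen separately for each `t` need not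
be, and then could not be integrated over time). -/
structure IsModifiedProb {Ω E : Type*} [MeasurableSpace Ω] (P : Measure Ω)
    (G : ℝ → MeasurableSpace Ω) (Z : ℝ → Ω → E) (Q : ℝ → Ω → ℝ) (pQ : E → ℝ → Ω → ℝ) : Prop where
  measurable : ∀ j, Measurable fun x : ℝ≥0 × Ω => pQ j x.1 x.2
  condExp : ∀ j t, 0 ≤ t → pQ j t =ᵐ[P] P[(Z t ⁻¹' {j}).indicator (Q t) | G t]

/-- The expected bonus cash flow rate `a^b(0, t) = ∑_j p^Q_j(t) (b_j + ∑_{k ≠ j} b_{jk} μ_{jk})`. -/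
def bonusCashFlow {Ω E : Type*} [Fintype E] [DecidableEq E] (μ : E → E → ℝ → ℝ)
    (b : E → ℝ → ℝ) (c : E → E → ℝ → ℝ) (pQ : E → ℝ → Ω → ℝ) (t : ℝ) (ω : Ω) : ℝ :=
  ∑ j, pQ j t ω * stateRate μ b c j t

end LifeBonus

end

noncomputable section

namespace LifeBonus

/-! ### Pathwise structure: finitely many jumps, and grid counts that converge to jump counts. -/

section Paths

variable {Ω E : Type*}

/-! The heart of the matter is a compensator argument in an enlarged filtration. Let `Y` be the
discounted number of bonus streams. Its paths are almost surely continuous, so off a null set it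
coincides on positive times with a process predictable for the filtration that knows all of the
market from time zero and reveals `Z` progressively. As `Z` is independent of the market, it keeps
its transition probabilities in this filtration (`IsMarkovWithRates.measure_sup_history`), and
`N_{jk}` has compensator `1_{Z(t) = j} μ_{jk}(t) dt` (`IsMarkovWithRates.setLIntegral_jumpMeasure`).
Replacing each `dN_{jk}` by its compensator turns the value into the integral of `Y` times
`stateRate` in the current state over `P ⊗ dt` (`IsMarkovWithRates.integral_bonusKernel`). That
integral is split by state and, at each `t`, conditioned on the market up to `t`: the discount
factor `s₀ / S₀(t)` comes out, and `Q(t) 1_{Z(t) = j}` becomes the modified probability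
(`integrable_and_integral_eq_of_condExp`).

The compensator is derived from the integrated forward equations. The moves from `j` to `k` over the
cells of a grid have an expectation given exactly by these equations. As the mesh tends to zero, the
counts become the true number of jumps on every path. In the integrals only the inflow from `j`
survives, because at almost every time `Z` almost surely does not jump.

A jointly measurable modified probability needs one conditional law for all times. Given the whole
market history such a law exists for the values of a right-continuous process at rational times
(`exists_measurable_condExp_comap`). Independence of `Z` then shows that conditioning on the whole
market or only on its past gives the same result (`condExp_eq_condExp_of_indep`).

If `Q` is market-adapted, it comes out of the conditional expectation, and what is left is the
unconditional law of `Z(t)`. -/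

theorem LeftState.unique {Z : ℝ → Ω → E} {ω : Ω} {t : ℝ} {j k : E}
    (hj : LeftState Z ω t j) (hk : LeftState Z ω t k) : j = k := by
  obtain ⟨s, hs⟩ := (Filter.Eventually.and hj hk).exists
  exact hs.1.symm.trans hs.2

/-- The times of all jumps of `Z` on the path `ω`. -/
def allJumpTimes (Z : ℝ → Ω → E) (ω : Ω) : Set ℝ :=
  {s | 0 < s ∧ ¬ LeftState Z ω s (Z s ω)}

theorem jumpTimes_subset_allJumpTimes {Z : ℝ → Ω → E} {ω : Ω} {j k : E} (hjk : j ≠ k) :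
    jumpTimes Z ω j k ⊆ allJumpTimes Z ω := by
  rintro s ⟨hs, hl, hk⟩
  refine ⟨hs, fun h => hjk ?_⟩
  rw [hk] at h
  exact hl.unique h

theorem jumpMeasure_apply (Z : ℝ → Ω → E) (ω : Ω) (j k : E) {B : Set ℝ} (hB : MeasurableSet B) :
    jumpMeasure Z ω j k B = ((jumpTimes Z ω j k ∩ B).encard : ℝ≥0∞) := by
  rw [jumpMeasure, Measure.sum_apply _ hB]
  simp only [Measure.dirac_apply' _ hB]
  rw [tsum_subtype (jumpTimes Z ω j k) (fun s => B.indicator (1 : ℝ → ℝ≥0∞) s),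
    Set.indicator_indicator]
  have := ENNReal.tsum_set_one (jumpTimes Z ω j k ∩ B)
  rw [← this, tsum_subtype (jumpTimes Z ω j k ∩ B) (fun _ => (1 : ℝ≥0∞))]
  rfl

variable [MeasurableSpace Ω] [MeasurableSpace E] {Z : ℝ → Ω → E} {z₀ : E}

/-- Infinitely many jumps in a compact interval would accumulate somewhere, but the left limit and
right-continuity make the path constant on each side of any point. -/
theorem IsJumpProcess.finite_allJumpTimes (hZ : IsJumpProcess Z z₀) (ω : Ω) (b : ℝ) :
    (allJumpTimes Z ω ∩ Iic b).Finite := by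
  by_contra hinf
  have hsub : allJumpTimes Z ω ∩ Iic b ⊆ Icc 0 b := fun s hs => ⟨hs.1.1.le, hs.2⟩
  obtain ⟨x, hx, hacc⟩ := Set.Infinite.exists_accPt_of_subset_isCompact hinf isCompact_Icc hsub
  have key : ∀ᶠ s in 𝓝[≠] x, s ∉ allJumpTimes Z ω := by
    rw [← Iio_union_Ioi, nhdsWithin_union, eventually_sup]
    constructor
    · rcases hx.1.eq_or_lt with h0 | h0
      · subst h0
        filter_upwards [self_mem_nhdsWithin] with s hs h
        exact absurd h.1 (not_lt.2 (le_of_lt hs))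
      · obtain ⟨j, hj⟩ := hZ.left_limit ω x h0
        have hj' : ∀ᶠ s in 𝓝[<] x, Z s ω = j := hj
        filter_upwards [self_mem_nhdsWithin, hj', eventually_eventually_nhdsWithin.2 hj']
          with s hs h1 h2 h
        refine h.2 ?_
        rw [h1]
        rw [IsOpen.nhdsWithin_eq isOpen_Iio hs] at h2
        exact h2.filter_mono nhdsWithin_le_nhds
    · have hj' := hZ.right_continuous ω x hx.1
      filter_upwards [self_mem_nhdsWithin, hj', eventually_eventually_nhdsWithin.2 hj']
        with s hs h1 h2 h
      refine h.2 ?_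
      rw [h1]
      rw [IsOpen.nhdsWithin_eq isOpen_Ioi hs] at h2
      exact h2.filter_mono nhdsWithin_le_nhds
  have hf := accPt_iff_frequently_nhdsNE.1 hacc
  exact hf (key.mono fun s hs h => hs h.1)

/-- Without jumps the path is continuous into the discrete space `E`, hence constant on a connected
interval. -/
theorem IsJumpProcess.eq_of_no_jump (hZ : IsJumpProcess Z z₀) (ω : Ω) {a b : ℝ} (ha : 0 ≤ a)
    (hab : a ≤ b) (h : ∀ x ∈ Ioc a b, x ∉ allJumpTimes Z ω) : Z b ω = Z a ω := by
  let _ : TopologicalSpace E := ⊥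
  have : DiscreteTopology E := ⟨rfl⟩
  have hc : ContinuousOn (fun x => Z x ω) (Icc a b) := by
    intro x hx
    have hx0 : 0 ≤ x := ha.trans hx.1
    have hev : ∀ᶠ s in 𝓝[Icc a b] x, Z s ω = Z x ω := by
      have hr : ∀ᶠ s in 𝓝[≥] x, Z s ω = Z x ω := by
        rw [← Ioi_insert, nhdsWithin_insert, eventually_sup]
        exact ⟨by simp, hZ.right_continuous ω x hx0⟩
      rcases hx.1.eq_or_lt with hax | hax
      · exact hr.filter_mono (nhdsWithin_mono _ (by rw [hax]; exact Icc_subset_Ici_self))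
      · have hn := h x ⟨hax, hx.2⟩
        have hl : LeftState Z ω x (Z x ω) := by
          by_contra hl
          exact hn ⟨ha.trans_lt hax, hl⟩
        have : ∀ᶠ s in 𝓝 x, Z s ω = Z x ω := by
          rw [← nhdsLT_sup_nhdsGE, eventually_sup]
          exact ⟨hl, hr⟩
        exact this.filter_mono nhdsWithin_le_nhds
    exact tendsto_nhds_of_eventually_eq hev
  exact isPreconnected_Icc.constant hc (right_mem_Icc.2 hab) (left_mem_Icc.2 hab)

/-- With at most one jump in the cell, the path equals its initial value before the jump and its
final value from then on, so the two endpoints reveal the type of the jump. -/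
theorem IsJumpProcess.jumpMeasure_eq_indicator (hZ : IsJumpProcess Z z₀) (ω : Ω) {a b : ℝ}
    (ha : 0 ≤ a) (hab : a ≤ b) {j k : E} (hjk : j ≠ k)
    (h : (allJumpTimes Z ω ∩ Ioc a b).Subsingleton) :
    jumpMeasure Z ω j k (Ioc a b) = (Z a ⁻¹' {j} ∩ Z b ⁻¹' {k}).indicator 1 ω := by
  rw [jumpMeasure_apply _ _ _ _ measurableSet_Ioc]
  rcases h.eq_empty_or_singleton with h0 | ⟨τ, hτ⟩
  · have h1 : jumpTimes Z ω j k ∩ Ioc a b = ∅ :=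
      subset_eq_empty (inter_subset_inter_left _ (jumpTimes_subset_allJumpTimes hjk)) h0
    have h2 : Z b ω = Z a ω := hZ.eq_of_no_jump ω ha hab fun x hx hx' => by
      have : x ∈ (∅ : Set ℝ) := h0 ▸ ⟨hx', hx⟩
      exact this
    rw [h1, Set.indicator_of_notMem]
    · simp
    · rintro ⟨h3, h4⟩
      exact hjk (h3.symm.trans (h2.symm.trans h4))
  · have hτm : τ ∈ allJumpTimes Z ω ∩ Ioc a b := hτ ▸ mem_singleton τ
    have huniq : ∀ x ∈ Ioc a b, x ∈ allJumpTimes Z ω → x = τ := fun x hx hx' => by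
      have : x ∈ ({τ} : Set ℝ) := hτ ▸ ⟨hx', hx⟩
      exact this
    have hb : Z b ω = Z τ ω := hZ.eq_of_no_jump ω hτm.1.1.le hτm.2.2 fun x hx hx' =>
      hx.1.ne' (huniq x ⟨hτm.2.1.trans hx.1, hx.2⟩ hx')
    have hl : LeftState Z ω τ (Z a ω) := by
      have : ∀ᶠ s in 𝓝[<] τ, s ∈ Ioo a τ := Ioo_mem_nhdsLT hτm.2.1
      refine this.mono fun s hs => ?_
      exact hZ.eq_of_no_jump ω ha hs.1.le fun x hx hx' =>
        (hx.2.trans_lt hs.2).ne (huniq x ⟨hx.1, hx.2.trans (hs.2.le.trans hτm.2.2)⟩ hx')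
    by_cases hm : ω ∈ Z a ⁻¹' {j} ∩ Z b ⁻¹' {k}
    · rw [indicator_of_mem hm]
      have : jumpTimes Z ω j k ∩ Ioc a b = {τ} := by
        refine Subset.antisymm (hτ ▸ inter_subset_inter_left _
          (jumpTimes_subset_allJumpTimes hjk)) ?_
        rintro x rfl
        refine ⟨⟨hτm.1.1, ?_, ?_⟩, hτm.2⟩
        · rw [← show Z a ω = j from hm.1]; exact hl
        · rw [← hb]; exact hm.2
      rw [this]; simp
    · rw [indicator_of_notMem hm]
      have : jumpTimes Z ω j k ∩ Ioc a b = ∅ := by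
        rw [eq_empty_iff_forall_notMem]
        rintro x ⟨hx, hx'⟩
        have := huniq x hx' (jumpTimes_subset_allJumpTimes hjk hx)
        subst this
        exact hm ⟨hl.unique hx.2.1, hb.trans hx.2.2⟩
      rw [this]; simp

theorem IsJumpProcess.one_le_sum_jumpMeasure [Fintype E] [DecidableEq E]
    (hZ : IsJumpProcess Z z₀) (ω : Ω) {a b : ℝ}
    (ha : 0 ≤ a) (hab : a ≤ b) (h : Z a ω ≠ Z b ω) :
    1 ≤ ∑ j, ∑ k ∈ Finset.univ.erase j, jumpMeasure Z ω j k (Ioc a b) := by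
  obtain ⟨x, hx, hx'⟩ : ∃ x ∈ Ioc a b, x ∈ allJumpTimes Z ω := by
    by_contra! hcon
    exact h (hZ.eq_of_no_jump ω ha hab hcon).symm
  obtain ⟨j, hj⟩ := hZ.left_limit ω x hx'.1
  have hjk : Z x ω ∈ Finset.univ.erase j := by
    refine Finset.mem_erase.2 ⟨fun hh => hx'.2 (hh ▸ hj), Finset.mem_univ _⟩
  calc (1 : ℝ≥0∞) ≤ jumpMeasure Z ω j (Z x ω) (Ioc a b) := by
        rw [jumpMeasure_apply _ _ _ _ measurableSet_Ioc]
        have : (1 : ℕ∞) ≤ (jumpTimes Z ω j (Z x ω) ∩ Ioc a b).encard :=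
          one_le_encard_iff_nonempty.2 ⟨x, ⟨hx'.1, hj, rfl⟩, hx⟩
        exact_mod_cast this
    _ ≤ ∑ k ∈ Finset.univ.erase j, jumpMeasure Z ω j k (Ioc a b) :=
        Finset.single_le_sum (f := fun k => jumpMeasure Z ω j k (Ioc a b)) (fun _ _ => zero_le) hjk
    _ ≤ _ := Finset.single_le_sum
        (f := fun j => ∑ k ∈ Finset.univ.erase j, jumpMeasure Z ω j k (Ioc a b))
        (fun _ _ => zero_le) (Finset.mem_univ j)

/-- The grid points `s + i (n - s) / (m + 1)`. -/
def gridPoint (s n : ℝ) (m i : ℕ) : ℝ := s + (n - s) / (m + 1) * i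

theorem gridPoint_zero (s n : ℝ) (m : ℕ) : gridPoint s n m 0 = s := by simp [gridPoint]

theorem gridPoint_last (s n : ℝ) (m : ℕ) : gridPoint s n m (m + 1) = n := by
  have : (m : ℝ) + 1 ≠ 0 := by positivity
  simp only [gridPoint]; push_cast; field_simp; ring

theorem gridPoint_mono {s n : ℝ} (hsn : s ≤ n) (m : ℕ) : Monotone (gridPoint s n m) := by
  intro i i' h
  have : 0 ≤ (n - s) / (m + 1) := div_nonneg (by linarith) (by positivity)
  have h' : (i : ℝ) ≤ i' := by exact_mod_cast h
  simp only [gridPoint]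
  nlinarith [mul_le_mul_of_nonneg_left h' this]

theorem le_gridPoint {s n : ℝ} (hsn : s ≤ n) (m i : ℕ) : s ≤ gridPoint s n m i := by
  exact (gridPoint_zero s n m).symm.le.trans (gridPoint_mono hsn m (Nat.zero_le i))

theorem gridPoint_succ_sub (s n : ℝ) (m i : ℕ) :
    gridPoint s n m (i + 1) - gridPoint s n m i = (n - s) / (m + 1) := by
  simp only [gridPoint]; push_cast; ring

theorem sum_measure_grid (ν : Measure ℝ) {s n : ℝ} (hsn : s ≤ n) (m : ℕ) :
    ∑ i ∈ Finset.range (m + 1), ν (Ioc (gridPoint s n m i) (gridPoint s n m (i + 1)))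
      = ν (Ioc s n) := by
  have key : ∀ l : ℕ, ∑ i ∈ Finset.range l,
      ν (Ioc (gridPoint s n m i) (gridPoint s n m (i + 1))) = ν (Ioc s (gridPoint s n m l)) := by
    intro l
    induction l with
    | zero => simp [gridPoint_zero]
    | succ l ih =>
      rw [Finset.sum_range_succ, ih, ← measure_union _ measurableSet_Ioc,
        Ioc_union_Ioc_eq_Ioc (le_gridPoint hsn m l) (gridPoint_mono hsn m l.le_succ)]
      rw [Set.disjoint_left]
      intro x hx hx'
      exact absurd hx.2 (not_le.2 hx'.1)
  rw [key, gridPoint_last]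

/-- The number of grid intervals over which `Z` moves from `j` to `k`. -/
def gridCount (Z : ℝ → Ω → E) (s n : ℝ) (j k : E) (m : ℕ) (ω : Ω) : ℝ≥0∞ :=
  ∑ i ∈ Finset.range (m + 1),
    (Z (gridPoint s n m i) ⁻¹' {j} ∩ Z (gridPoint s n m (i + 1)) ⁻¹' {k}).indicator 1 ω

/-- The finitely many jump times have a positive minimal distance; once the mesh is smaller, no cell
contains two of them. -/
theorem IsJumpProcess.eventually_gridCount_eq (hZ : IsJumpProcess Z z₀) (ω : Ω) {s n : ℝ}
    (hs : 0 ≤ s) (hsn : s ≤ n) {j k : E} (hjk : j ≠ k) :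
    ∀ᶠ m in atTop, gridCount Z s n j k m ω = jumpMeasure Z ω j k (Ioc s n) := by
  set J := allJumpTimes Z ω ∩ Iic n with hJ
  have hfin : J.Finite := hZ.finite_allJumpTimes ω n
  have hpos : 0 < J.einfsep := hfin.einfsep_pos
  have hlim : Tendsto (fun m : ℕ => ENNReal.ofReal ((n - s) / ((m : ℝ) + 1))) atTop (𝓝 0) := by
    rw [← ENNReal.ofReal_zero]
    refine ENNReal.tendsto_ofReal ?_
    have := (tendsto_one_div_add_atTop_nhds_zero_nat (𝕜 := ℝ)).const_mul (n - s)
    simpa [div_eq_mul_inv] using this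
  filter_upwards [hlim.eventually_lt_const hpos] with m hm
  rw [← sum_measure_grid _ hsn m, gridCount]
  refine Finset.sum_congr rfl fun i hi => ?_
  have hin : gridPoint s n m (i + 1) ≤ n := by
    conv_rhs => rw [← gridPoint_last s n m]
    exact gridPoint_mono hsn m (by simpa using hi)
  refine (hZ.jumpMeasure_eq_indicator ω (hs.trans (le_gridPoint hsn m i))
    (gridPoint_mono hsn m i.le_succ) hjk ?_).symm
  intro x hx y hy
  by_contra hxy
  have h1 := Set.einfsep_le_edist_of_mem (s := J) (x := x) (y := y) ⟨hx.1, hx.2.2.trans hin⟩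
    ⟨hy.1, hy.2.2.trans hin⟩ hxy
  have h2 : edist x y ≤ ENNReal.ofReal ((n - s) / ((m : ℝ) + 1)) := by
    rw [edist_dist, Real.dist_eq]
    refine ENNReal.ofReal_le_ofReal ?_
    rw [← gridPoint_succ_sub s n m i, abs_le]
    constructor <;> linarith [hx.2.1, hx.2.2, hy.2.1, hy.2.2]
  exact absurd (h1.trans h2) (not_le.2 hm)

/-- A bound uniform in the mesh, for dominated convergence. All types of jumps must be summed, since
a cell with endpoints `j` and `k` may be crossed through other states. -/
theorem IsJumpProcess.gridCount_le [Fintype E] [DecidableEq E] (hZ : IsJumpProcess Z z₀) (ω : Ω)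
    {s n : ℝ} (hs : 0 ≤ s) (hsn : s ≤ n) {j k : E} (hjk : j ≠ k) (m : ℕ) :
    gridCount Z s n j k m ω ≤
      ∑ j, ∑ k ∈ Finset.univ.erase j, jumpMeasure Z ω j k (Ioc s n) := by
  calc gridCount Z s n j k m ω ≤ ∑ i ∈ Finset.range (m + 1),
        ∑ j, ∑ k ∈ Finset.univ.erase j,
          jumpMeasure Z ω j k (Ioc (gridPoint s n m i) (gridPoint s n m (i + 1))) := by
        refine Finset.sum_le_sum fun i _ => ?_
        by_cases hm : ω ∈ Z (gridPoint s n m i) ⁻¹' {j} ∩ Z (gridPoint s n m (i + 1)) ⁻¹' {k}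
        · rw [indicator_of_mem hm]
          refine hZ.one_le_sum_jumpMeasure ω (hs.trans (le_gridPoint hsn m i))
            (gridPoint_mono hsn m i.le_succ) ?_
          rw [show Z (gridPoint s n m i) ω = j from hm.1,
            show Z (gridPoint s n m (i + 1)) ω = k from hm.2]
          exact hjk
        · rw [indicator_of_notMem hm]; exact zero_le
    _ = _ := by
        rw [Finset.sum_comm]
        refine Finset.sum_congr rfl fun j _ => ?_
        rw [Finset.sum_comm]
        exact Finset.sum_congr rfl fun k _ => sum_measure_grid _ hsn m

theorem IsJumpProcess.jumpMeasure_lt_top (hZ : IsJumpProcess Z z₀) (ω : Ω) {j k : E}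
    (hjk : j ≠ k) (s n : ℝ) : jumpMeasure Z ω j k (Ioc s n) < ∞ := by
  rw [jumpMeasure_apply _ _ _ _ measurableSet_Ioc]
  have : (jumpTimes Z ω j k ∩ Ioc s n).Finite := (hZ.finite_allJumpTimes ω n).subset
    (inter_subset_inter (jumpTimes_subset_allJumpTimes hjk) Ioc_subset_Iic_self)
  simpa using this

variable [MeasurableSingletonClass E]

theorem IsJumpProcess.measurable_gridCount (hZ : IsJumpProcess Z z₀) {s n : ℝ}
    (hs : 0 ≤ s) (hsn : s ≤ n) (j k : E) (m : ℕ) : Measurable (gridCount Z s n j k m) := by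
  unfold gridCount
  refine Finset.measurable_sum _ fun i _ => measurable_one.indicator ?_
  exact (hZ.measurable _ (hs.trans (le_gridPoint hsn m i)) (measurableSet_singleton j)).inter
    (hZ.measurable _ (hs.trans (le_gridPoint hsn m (i + 1))) (measurableSet_singleton k))

theorem IsJumpProcess.measurable_jumpMeasure_Ioc (hZ : IsJumpProcess Z z₀) {s n : ℝ}
    (hs : 0 ≤ s) {j k : E} (hjk : j ≠ k) :
    Measurable fun ω => jumpMeasure Z ω j k (Ioc s n) := by
  rcases le_or_gt s n with hsn | hsn
  · refine measurable_of_tendsto_metrizable (fun m => hZ.measurable_gridCount hs hsn j k m) ?_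
    rw [tendsto_pi_nhds]
    intro ω
    exact tendsto_nhds_of_eventually_eq (hZ.eventually_gridCount_eq ω hs hsn hjk)
  · simp [Ioc_eq_empty hsn.le.not_gt]

end Paths

/-! ### Grid points strictly to the left of a time. -/

section Grid

/-- The last point strictly before `t` of the grid with origin `s` and mesh `h`. -/
def leftGrid (s h t : ℝ) : ℝ := s + h * (⌈(t - s) / h⌉ - 1)

theorem leftGrid_lt {s h t : ℝ} (hh : 0 < h) : leftGrid s h t < t := by
  have h1 := Int.ceil_lt_add_one ((t - s) / h)
  have h2 : h * ((⌈(t - s) / h⌉ : ℝ) - 1) < h * ((t - s) / h) := by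
    apply mul_lt_mul_of_pos_left _ hh; linarith
  rw [mul_div_cancel₀ _ hh.ne'] at h2
  unfold leftGrid; linarith

theorem sub_le_leftGrid {s h t : ℝ} (hh : 0 < h) : t - h ≤ leftGrid s h t := by
  have h1 := Int.le_ceil ((t - s) / h)
  have h2 : h * ((t - s) / h) ≤ h * (⌈(t - s) / h⌉ : ℝ) := mul_le_mul_of_nonneg_left h1 hh.le
  rw [mul_div_cancel₀ _ hh.ne'] at h2
  unfold leftGrid; linarith

theorem le_leftGrid {s h t : ℝ} (hh : 0 < h) (hst : s < t) : s ≤ leftGrid s h t := by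
  have h1 : 1 ≤ ⌈(t - s) / h⌉ := Int.one_le_ceil_iff.2 (div_pos (sub_pos.2 hst) hh)
  have h2 : (1 : ℝ) ≤ ⌈(t - s) / h⌉ := by exact_mod_cast h1
  unfold leftGrid
  nlinarith [mul_nonneg hh.le (sub_nonneg.2 h2)]

theorem leftGrid_eq {s h t : ℝ} (hh : 0 < h) {i : ℕ}
    (ht : t ∈ Ioc (s + h * i) (s + h * (i + 1 : ℕ))) : leftGrid s h t = s + h * i := by
  have h1 : ⌈(t - s) / h⌉ = (i : ℤ) + 1 := by
    rw [Int.ceil_eq_iff]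
    push_cast
    constructor
    · rw [lt_div_iff₀ hh]; linarith [ht.1]
    · rw [div_le_iff₀ hh]; have := ht.2; push_cast at this; linarith
  unfold leftGrid
  rw [h1]; push_cast; ring

theorem exists_mem_grid {s h t : ℝ} (hh : 0 < h) (hst : s < t) :
    ∃ i : ℕ, t ∈ Ioc (s + h * i) (s + h * (i + 1 : ℕ)) := by
  have h1 : 1 ≤ ⌈(t - s) / h⌉ := Int.one_le_ceil_iff.2 (div_pos (sub_pos.2 hst) hh)
  obtain ⟨i, hi⟩ := Int.eq_ofNat_of_zero_le (sub_nonneg.2 h1)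
  have h2 : ⌈(t - s) / h⌉ = (i : ℤ) + 1 := by omega
  rw [Int.ceil_eq_iff] at h2
  push_cast at h2
  rw [lt_div_iff₀ hh, div_le_iff₀ hh] at h2
  refine ⟨i, ?_, ?_⟩
  · linarith [h2.1]
  · push_cast; linarith [h2.2]

theorem tendsto_leftGrid {s t : ℝ} {h : ℕ → ℝ} (hpos : ∀ m, 0 < h m)
    (hlim : Tendsto h atTop (𝓝 0)) : Tendsto (fun m => leftGrid s (h m) t) atTop (𝓝[<] t) := by
  refine tendsto_nhdsWithin_iff.2 ⟨?_, Eventually.of_forall fun m => leftGrid_lt (hpos m)⟩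
  refine tendsto_of_tendsto_of_tendsto_of_le_of_le ?_ tendsto_const_nhds
    (fun m => sub_le_leftGrid (hpos m)) (fun m => (leftGrid_lt (hpos m)).le)
  simpa using hlim.const_sub t

end Grid

/-! ### Predictable sets and predictable versions. -/

section Predictable

variable {Ω E : Type*}

/-- The predictable `σ`-algebra on `Ω × (0, ∞)`, seen as a `σ`-algebra on `Ω × ℝ`. -/
@[reducible] def predictable (F : ℝ → MeasurableSpace Ω) : MeasurableSpace (Ω × ℝ) :=
  MeasurableSpace.generateFrom {R | ∃ s, 0 ≤ s ∧ ∃ C, MeasurableSet[F s] C ∧ R = C ×ˢ Ioi s}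

theorem measurableSet_predictable_Ioi {F : ℝ → MeasurableSpace Ω} {s : ℝ} (hs : 0 ≤ s)
    {C : Set Ω} (hC : MeasurableSet[F s] C) : MeasurableSet[predictable F] (C ×ˢ Ioi s) :=
  MeasurableSpace.measurableSet_generateFrom ⟨s, hs, C, hC, rfl⟩

theorem isPiSystem_predictable {F : ℝ → MeasurableSpace Ω} (hF : Monotone F) :
    IsPiSystem {R | ∃ s, 0 ≤ s ∧ ∃ C, MeasurableSet[F s] C ∧ R = C ×ˢ Ioi s} := by
  rintro _ ⟨s, hs, C, hC, rfl⟩ _ ⟨t, ht, D, hD, rfl⟩ -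
  refine ⟨max s t, le_max_of_le_left hs, C ∩ D, ?_, ?_⟩
  · exact MeasurableSet.inter (hF (le_max_left s t) _ hC) (hF (le_max_right s t) _ hD)
  · rw [prod_inter_prod, Ioi_inter_Ioi]

theorem predictable_le [m : MeasurableSpace Ω] {F : ℝ → MeasurableSpace Ω} (hF : ∀ s, F s ≤ m) :
    predictable F ≤ Prod.instMeasurableSpace := by
  refine MeasurableSpace.generateFrom_le ?_
  rintro _ ⟨s, -, C, hC, rfl⟩
  exact (hF s _ hC).prod measurableSet_Ioi

theorem measurableSet_predictable_Ioc {F : ℝ → MeasurableSpace Ω} (hF : Monotone F) {s t : ℝ}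
    (hs : 0 ≤ s) (hst : s ≤ t) {C : Set Ω} (hC : MeasurableSet[F s] C) :
    MeasurableSet[predictable F] (C ×ˢ Ioc s t) := by
  have : C ×ˢ Ioc s t = C ×ˢ Ioi s \ C ×ˢ Ioi t := by
    ext ⟨ω, u⟩
    simp only [mem_prod, mem_Ioc, Set.mem_sdiff, mem_Ioi, not_and, not_lt]
    tauto
  rw [this]
  exact (measurableSet_predictable_Ioi hs hC).diff
    (measurableSet_predictable_Ioi (hs.trans hst) (hF hst _ hC))

/-- On each cell the sampled process is frozen at its value at the left endpoint, which is already
known there; the set is a countable union of predictable rectangles. -/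
theorem measurableSet_predictable_leftGrid {β : Type*} [MeasurableSpace β]
    {F : ℝ → MeasurableSpace Ω} (hF : Monotone F) {X : ℝ → Ω → β}
    (hX : ∀ t, 0 ≤ t → Measurable[F t] (X t)) {s h : ℝ} (hs : 0 ≤ s) (hh : 0 < h) {B : Set β}
    (hB : MeasurableSet B) :
    MeasurableSet[predictable F] {x : Ω × ℝ | s < x.2 ∧ X (leftGrid s h x.2) x.1 ∈ B} := by
  have : {x : Ω × ℝ | s < x.2 ∧ X (leftGrid s h x.2) x.1 ∈ B} =
      ⋃ i : ℕ, (X (s + h * i) ⁻¹' B) ×ˢ Ioc (s + h * i) (s + h * (i + 1 : ℕ)) := by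
    ext ⟨ω, t⟩
    simp only [mem_ofPred_eq, mem_iUnion, mem_prod, mem_preimage]
    constructor
    · rintro ⟨hst, hx⟩
      obtain ⟨i, hi⟩ := exists_mem_grid hh hst
      exact ⟨i, by rwa [← leftGrid_eq hh hi], hi⟩
    · rintro ⟨i, hx, hi⟩
      refine ⟨lt_of_le_of_lt ?_ hi.1, by rwa [leftGrid_eq hh hi]⟩
      have : 0 ≤ h * (i : ℝ) := by positivity
      linarith
  rw [this]
  refine MeasurableSet.iUnion fun i => ?_
  have hi : 0 ≤ s + h * (i : ℝ) := by positivity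
  refine measurableSet_predictable_Ioc hF hi ?_ (hX _ hi hB)
  push_cast; nlinarith

/-- The filtration is not completed, so an almost surely continuous adapted process need not itself
be predictable; this version agrees with it on every continuous path. -/
theorem exists_predictable_of_continuousOn {F : ℝ → MeasurableSpace Ω} (hF : Monotone F)
    {X : ℝ → Ω → ℝ} (hX : ∀ t, 0 ≤ t → Measurable[F t] (X t)) :
    ∃ Y : Ω × ℝ → ℝ, Measurable[predictable F] Y ∧
      ∀ ω, ContinuousOn (fun t => X t ω) (Ici 0) → ∀ t, 0 < t → Y (ω, t) = X t ω := by
  let h : ℕ → ℝ := fun m => 1 / ((m : ℝ) + 1)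
  have hpos : ∀ m, 0 < h m := fun m => by positivity
  let Xm : ℕ → Ω × ℝ → ℝ := fun m => {x : Ω × ℝ | 0 < x.2}.indicator
    fun x => X (leftGrid 0 (h m) x.2) x.1
  have hXm : ∀ m, Measurable[predictable F] (Xm m) := by
    intro m B hB
    have h1 := measurableSet_predictable_leftGrid hF hX le_rfl (hpos m) hB
    have h2 := measurableSet_predictable_leftGrid hF hX le_rfl (hpos m) MeasurableSet.univ
    have : Xm m ⁻¹' B = {x : Ω × ℝ | 0 < x.2 ∧ X (leftGrid 0 (h m) x.2) x.1 ∈ B} ∪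
        ({x : Ω × ℝ | 0 < x.2 ∧ X (leftGrid 0 (h m) x.2) x.1 ∈ univ}ᶜ ∩ {_x | (0 : ℝ) ∈ B}) := by
      ext x
      by_cases hx : 0 < x.2 <;> simp [Xm, indicator, hx]
    rw [this]
    exact h1.union (h2.compl.inter (MeasurableSet.const _))
  -- The `limsup` is measurable everywhere, whatever value it takes where the left-grid samples do
  -- not converge.
  refine ⟨fun x => limsup (fun m => Xm m x) atTop, Measurable.limsup hXm, ?_⟩
  intro ω hω t ht
  have hlim : Tendsto (fun m => Xm m (ω, t)) atTop (𝓝 (X t ω)) := by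
    have h1 : ContinuousAt (fun t => X t ω) t := (hω t ht.le).continuousAt (Ici_mem_nhds ht)
    have h2 := h1.tendsto.comp ((tendsto_leftGrid (s := 0) hpos
      tendsto_one_div_add_atTop_nhds_zero_nat).mono_right nhdsWithin_le_nhds)
    refine h2.congr fun m => ?_
    simp [Xm, ht]
  exact hlim.limsup_eq

variable [MeasurableSpace Ω] [MeasurableSpace E] {Z : ℝ → Ω → E} {z₀ : E}

/-- Since a left limit is known to exist, the countably many samples at left grid points identify
it. -/
theorem IsJumpProcess.leftState_iff (hZ : IsJumpProcess Z z₀) {ω : Ω} {t : ℝ} (ht : 0 < t)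
    {s : ℝ} {h : ℕ → ℝ} (hpos : ∀ m, 0 < h m) (hlim : Tendsto h atTop (𝓝 0)) {j : E} :
    LeftState Z ω t j ↔ ∀ᶠ m in atTop, Z (leftGrid s (h m) t) ω = j := by
  have hg := tendsto_leftGrid (s := s) (t := t) hpos hlim
  refine ⟨fun hj => hg.eventually hj, fun hj => ?_⟩
  obtain ⟨k, hk⟩ := hZ.left_limit ω t ht
  obtain ⟨m, hm⟩ := (hj.and (hg.eventually hk)).exists
  rwa [← hm.1, hm.2]

theorem IsJumpProcess.measurableSet_leftState [MeasurableSingletonClass E]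
    (hZ : IsJumpProcess Z z₀) {F : ℝ → MeasurableSpace Ω} (hF : Monotone F)
    (hZF : ∀ t, 0 ≤ t → Measurable[F t] (Z t)) (j : E) :
    MeasurableSet[predictable F] {x : Ω × ℝ | 0 < x.2 ∧ LeftState Z x.1 x.2 j} := by
  have : {x : Ω × ℝ | 0 < x.2 ∧ LeftState Z x.1 x.2 j} = ⋃ N : ℕ, ⋂ m ≥ N,
      {x : Ω × ℝ | 0 < x.2 ∧ Z (leftGrid 0 (1 / ((m : ℝ) + 1)) x.2) x.1 ∈ ({j} : Set E)} := by
    ext x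
    simp only [mem_ofPred_eq, mem_iUnion, mem_iInter, mem_singleton_iff]
    by_cases hx : 0 < x.2
    · rw [hZ.leftState_iff hx (s := 0) (h := fun m : ℕ => 1 / ((m : ℝ) + 1))
        (fun m => by positivity) tendsto_one_div_add_atTop_nhds_zero_nat, eventually_atTop]
      simp [hx]
    · simp only [hx, false_and, false_iff]
      rintro ⟨N, hN⟩
      exact hN N le_rfl
  rw [this]
  refine MeasurableSet.iUnion fun N => MeasurableSet.iInter fun m => MeasurableSet.iInter fun _ => ?_
  exact measurableSet_predictable_leftGrid hF hZF le_rfl (by positivity) (measurableSet_singleton j)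

end Predictable

/-! ### Recovering right-continuous paths from countably many values. -/

section RightGrid

/-- The values of a path at the positive rational times. -/
def skeleton {Ω : Type*} (X : ℝ → Ω → ℝ) (ω : Ω) (q : ℕ × ℕ) : ℝ :=
  X (((q.2 : ℝ) + 1) / ((q.1 : ℝ) + 1)) ω

/-- The value at time `t` of the right-continuous path with skeleton `y`. -/
def ofSkeleton (x : ℝ≥0 × (ℕ × ℕ → ℝ)) : ℝ :=
  limsup (fun m : ℕ => x.2 (m, ⌊((m : ℝ≥0) + 1) * x.1⌋₊)) atTop

theorem measurable_ofSkeleton : Measurable ofSkeleton := by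
  refine Measurable.limsup fun m => ?_
  have h1 : Measurable fun x : ℝ≥0 × (ℕ × ℕ → ℝ) => ⌊((m : ℝ≥0) + 1) * x.1⌋₊ :=
    (measurable_fst.const_mul _).nat_floor
  have h2 : Measurable fun z : ℕ × (ℕ × ℕ → ℝ) => z.2 (m, z.1) :=
    measurable_from_prod_countable_right fun k => measurable_pi_apply (m, k)
  exact h2.comp (h1.prodMk measurable_snd)

/-- The sampling point `(⌊(m+1)t⌋ + 1)/(m+1)` lies strictly to the right of `t` and within `1/(m+1)`
of it, so only the right limit matters. -/
theorem ofSkeleton_skeleton {Ω : Type*} {X : ℝ → Ω → ℝ} {ω : Ω} {t : ℝ≥0}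
    (h : Tendsto (fun s => X s ω) (𝓝[>] (t : ℝ)) (𝓝 (X t ω))) :
    ofSkeleton (t, skeleton X ω) = X t ω := by
  refine Tendsto.limsup_eq (h.comp ?_)
  refine tendsto_nhdsWithin_iff.2 ⟨?_, Eventually.of_forall fun m => ?_⟩
  · have h1 : Tendsto (fun m : ℕ => (t : ℝ) + 1 / ((m : ℝ) + 1)) atTop (𝓝 t) := by
      simpa using (tendsto_one_div_add_atTop_nhds_zero_nat (𝕜 := ℝ)).const_add (t : ℝ)
    refine tendsto_of_tendsto_of_tendsto_of_le_of_le tendsto_const_nhds h1 (fun m => ?_)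
      fun m => ?_
    · have := Nat.lt_floor_add_one (((m : ℝ≥0) + 1) * t)
      have h2 : ((m : ℝ) + 1) * t < (⌊((m : ℝ≥0) + 1) * t⌋₊ : ℝ) + 1 := by exact_mod_cast this
      simp only
      rw [le_div_iff₀ (by positivity)]; linarith
    · have := Nat.floor_le (zero_le : 0 ≤ ((m : ℝ≥0) + 1) * t)
      have h2 : (⌊((m : ℝ≥0) + 1) * t⌋₊ : ℝ) ≤ ((m : ℝ) + 1) * t := by exact_mod_cast this
      simp only
      have h3 : 1 / ((m : ℝ) + 1) * ((m : ℝ) + 1) = 1 := one_div_mul_cancel (by positivity)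
      rw [div_le_iff₀ (by positivity)]
      linarith [add_mul (t : ℝ) (1 / ((m : ℝ) + 1)) ((m : ℝ) + 1)]
  · have := Nat.lt_floor_add_one (((m : ℝ≥0) + 1) * t)
    have h2 : ((m : ℝ) + 1) * t < (⌊((m : ℝ≥0) + 1) * t⌋₊ : ℝ) + 1 := by exact_mod_cast this
    rw [mem_Ioi, lt_div_iff₀ (by positivity)]; linarith

theorem measurable_skeleton {Ω : Type*} [MeasurableSpace Ω] {X : ℝ → Ω → ℝ}
    (hX : ∀ t, 0 ≤ t → Measurable (X t)) : Measurable (skeleton X) :=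
  measurable_pi_lambda _ fun q => hX _ (by positivity)

theorem IsJumpProcess.measurableSet_state {Ω E : Type*} [MeasurableSpace Ω] [MeasurableSpace E]
    [MeasurableSingletonClass E] {Z : ℝ → Ω → E} {z₀ : E} (hZ : IsJumpProcess Z z₀) (j : E) :
    MeasurableSet {x : Ω × ℝ | 0 ≤ x.2 ∧ Z x.2 x.1 = j} := by
  let X : ℝ → Ω → ℝ := fun t => (Z t ⁻¹' {j}).indicator 1
  have hX : ∀ t, 0 ≤ t → Measurable (X t) := fun t ht =>
    measurable_one.indicator (hZ.measurable t ht (measurableSet_singleton j))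
  have hm : Measurable fun x : Ω × ℝ => ofSkeleton (x.2.toNNReal, skeleton X x.1) :=
    measurable_ofSkeleton.comp (measurable_snd.real_toNNReal.prodMk
      ((measurable_skeleton hX).comp measurable_fst))
  have : {x : Ω × ℝ | 0 ≤ x.2 ∧ Z x.2 x.1 = j} =
      {x | 0 ≤ x.2} ∩ {x | ofSkeleton (x.2.toNNReal, skeleton X x.1) = 1} := by
    ext ⟨ω, t⟩
    simp only [mem_ofPred_eq, mem_inter_iff, and_congr_right_iff]
    intro ht
    rw [ofSkeleton_skeleton, Real.coe_toNNReal t ht]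
    · by_cases h : Z t ω = j <;> simp [X, h]
    · rw [Real.coe_toNNReal t ht]
      refine tendsto_nhds_of_eventually_eq ((hZ.right_continuous ω t ht).mono fun s hs => ?_)
      by_cases h : Z t ω = j
      · simp [X, h, hs.trans h]
      · simp [X, h, show Z s ω ≠ j from fun h' => h (hs.symm.trans h')]
  rw [this]
  exact (measurableSet_le measurable_const measurable_snd).inter
    (hm (measurableSet_singleton (1 : ℝ)))

end RightGrid

/-! ### Histories and uniqueness of measures on joins of σ-algebras. -/

section Histories

variable {Ω E β : Type*} [MeasurableSpace E] [MeasurableSpace β]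

theorem history_mono (X : ℝ → Ω → β) : Monotone (history X) := fun _ _ hst =>
  biSup_mono fun _ hu => ⟨hu.1, hu.2.trans hst⟩

theorem history_le_fullHistory (X : ℝ → Ω → β) (t : ℝ) : history X t ≤ fullHistory X :=
  biSup_mono fun _ hu => hu.1

theorem fullHistory_le [m : MeasurableSpace Ω] {X : ℝ → Ω → β}
    (hX : ∀ t, 0 ≤ t → Measurable (X t)) : fullHistory X ≤ m :=
  iSup₂_le fun t ht => (hX t ht).comap_le

theorem measurable_history {X : ℝ → Ω → β} {s t : ℝ} (hs : 0 ≤ s) (hst : s ≤ t) :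
    Measurable[history X t] (X s) :=
  measurable_iff_comap_le.2 (le_iSup₂_of_le (f := fun u (_ : u ∈ Icc (0 : ℝ) t) =>
    MeasurableSpace.comap (X u) inferInstance) s ⟨hs, hst⟩ le_rfl)

theorem generateFrom_inter_eq_sup (G H : MeasurableSpace Ω) :
    MeasurableSpace.generateFrom
      {C | ∃ A B, MeasurableSet[G] A ∧ MeasurableSet[H] B ∧ C = A ∩ B} = G ⊔ H := by
  refine le_antisymm (MeasurableSpace.generateFrom_le ?_) (sup_le ?_ ?_)
  · rintro _ ⟨A, B, hA, hB, rfl⟩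
    exact MeasurableSet.inter ((le_sup_left : G ≤ G ⊔ H) _ hA) ((le_sup_right : H ≤ G ⊔ H) _ hB)
  · intro A hA
    exact MeasurableSpace.measurableSet_generateFrom
      ⟨A, univ, hA, MeasurableSet.univ, (inter_univ A).symm⟩
  · intro B hB
    exact MeasurableSpace.measurableSet_generateFrom
      ⟨univ, B, MeasurableSet.univ, hB, (univ_inter B).symm⟩

/-- The intersections `A ∩ B` form a π-system that generates the join. -/
theorem measure_eq_of_inter_eq {G H : MeasurableSpace Ω} [m : MeasurableSpace Ω]
    {ν₁ ν₂ : Measure Ω} [IsFiniteMeasure ν₁] (hG : G ≤ m) (hH : H ≤ m)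
    (h : ∀ A B, MeasurableSet[G] A → MeasurableSet[H] B → ν₁ (A ∩ B) = ν₂ (A ∩ B)) {C : Set Ω}
    (hC : MeasurableSet[G ⊔ H] C) : ν₁ C = ν₂ C := by
  have hle : G ⊔ H ≤ m := sup_le hG hH
  have key : ν₁.trim hle = ν₂.trim hle := by
    refine ext_of_generate_finite _ (generateFrom_inter_eq_sup G H).symm ?_ ?_ ?_
    · rintro _ ⟨A, B, hA, hB, rfl⟩ _ ⟨A', B', hA', hB', rfl⟩ -
      exact ⟨A ∩ A', B ∩ B', MeasurableSet.inter hA hA', MeasurableSet.inter hB hB',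
        inter_inter_inter_comm _ _ _ _⟩
    · rintro _ ⟨A, B, hA, hB, rfl⟩
      have : MeasurableSet[G ⊔ H] (A ∩ B) := MeasurableSet.inter
        ((le_sup_left : G ≤ G ⊔ H) _ hA) ((le_sup_right : H ≤ G ⊔ H) _ hB)
      rw [trim_measurableSet_eq hle this, trim_measurableSet_eq hle this, h A B hA hB]
    · rw [trim_measurableSet_eq hle MeasurableSet.univ, trim_measurableSet_eq hle MeasurableSet.univ,
        ← inter_univ (univ : Set Ω), h univ univ MeasurableSet.univ MeasurableSet.univ]
  rw [← trim_measurableSet_eq hle hC, key, trim_measurableSet_eq hle hC]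

end Histories

/-! ### No jumps at fixed times; the Markov property given the market. -/

section Compensator

variable {Ω E : Type*} {G : MeasurableSpace Ω} [mΩ : MeasurableSpace Ω] [MeasurableSpace E] [MeasurableSingletonClass E]
  [Fintype E] {P : Measure Ω} [IsProbabilityMeasure P]
  {Z : ℝ → Ω → E} {z₀ : E} {p : ℝ → ℝ → E → E → ℝ} {μ : E → E → ℝ → ℝ}

theorem IsJumpProcess.measurableSet_allJumpTimes (hZ : IsJumpProcess Z z₀) :
    MeasurableSet {x : Ω × ℝ | x.2 ∈ allJumpTimes Z x.1} := by
  have : {x : Ω × ℝ | x.2 ∈ allJumpTimes Z x.1} = {x | 0 < x.2} \ ⋃ j,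
      ({x | 0 < x.2 ∧ LeftState Z x.1 x.2 j} ∩ {x | 0 ≤ x.2 ∧ Z x.2 x.1 = j}) := by
    ext x
    simp only [Set.mem_sdiff, mem_ofPred_eq, mem_iUnion, mem_inter_iff, not_exists, allJumpTimes]
    refine and_congr_right fun hw => ?_
    constructor
    · rintro h j ⟨⟨_, h1⟩, _, h2⟩
      exact h (h2 ▸ h1)
    · intro h h'
      exact h (Z x.2 x.1) ⟨⟨hw, h'⟩, hw.le, rfl⟩
  rw [this]
  refine (measurableSet_lt measurable_const measurable_snd).diff
    (MeasurableSet.iUnion fun j => MeasurableSet.inter ?_ (hZ.measurableSet_state j))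
  exact predictable_le (F := fun _ => mΩ) (fun _ => le_rfl) _
    (hZ.measurableSet_leftState monotone_const hZ.measurable j)

theorem IsJumpProcess.ae_ae_notMem_allJumpTimes (hZ : IsJumpProcess Z z₀) :
    ∀ᵐ ω ∂P, ∀ᵐ w ∂(volume : Measure ℝ), w ∉ allJumpTimes Z ω := by
  refine Eventually.of_forall fun ω => ?_
  have hc : (allJumpTimes Z ω).Countable := by
    have : allJumpTimes Z ω = ⋃ m : ℕ, allJumpTimes Z ω ∩ Iic (m : ℝ) := by
      rw [← inter_iUnion, iUnion_Iic_of_not_bddAbove_range, inter_univ]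
      rw [not_bddAbove_iff]
      intro x
      obtain ⟨m, hm⟩ := exists_nat_gt x
      exact ⟨m, ⟨m, rfl⟩, hm⟩
    rw [this]
    exact countable_iUnion fun m => (hZ.finite_allJumpTimes ω m).countable
  exact measure_eq_zero_iff_ae_notMem.1 (hc.measure_zero volume)

/-- Each path has countably many jumps, a Lebesgue null set; Fubini exchanges the two quantifiers.
-/
theorem IsJumpProcess.ae_ae_leftState (hZ : IsJumpProcess Z z₀) :
    ∀ᵐ w ∂(volume : Measure ℝ), 0 < w → ∀ᵐ ω ∂P, LeftState Z ω w (Z w ω) := by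
  filter_upwards [(Measure.ae_ae_comm (p := fun ω w => w ∉ allJumpTimes Z ω)
    hZ.measurableSet_allJumpTimes.compl).1 (hZ.ae_ae_notMem_allJumpTimes (P := P))] with w hw hw0
  filter_upwards [hw] with ω hω
  by_contra h
  exact hω ⟨hw0, h⟩

theorem IsJumpProcess.ae_leftState_iff (hZ : IsJumpProcess Z z₀) (n : ℝ) :
    ∀ᵐ x ∂(P.prod (volume.restrict (Ioc 0 n))), 0 < x.2 ∧
      ∀ j, LeftState Z x.1 x.2 j ↔ Z x.2 x.1 = j := by
  have h1 : ∀ᵐ x ∂(P.prod (volume.restrict (Ioc 0 n))), x.2 ∉ allJumpTimes Z x.1 :=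
    (Measure.ae_prod_iff_ae_ae hZ.measurableSet_allJumpTimes.compl).2
      (hZ.ae_ae_notMem_allJumpTimes.mono fun ω hω => ae_restrict_of_ae hω)
  have h2 : ∀ᵐ x ∂(P.prod (volume.restrict (Ioc 0 n))), x.2 ∈ Ioc 0 n :=
    Measure.quasiMeasurePreserving_snd.ae (ae_restrict_mem measurableSet_Ioc)
  filter_upwards [h1, h2] with x hx hx'
  have hl : LeftState Z x.1 x.2 (Z x.2 x.1) := by
    by_contra h
    exact hx ⟨hx'.1, h⟩
  exact ⟨hx'.1, fun j => ⟨fun h => hl.unique h, fun h => h ▸ hl⟩⟩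

variable [DecidableEq E]

theorem IsMarkovWithRates.measure_history (hM : IsMarkovWithRates P Z p μ)
    (hZ : IsJumpProcess Z z₀) {s t : ℝ} (hs : 0 ≤ s) (hst : s ≤ t) {B : Set Ω}
    (hB : MeasurableSet[history Z s] B) (i j : E) :
    P (B ∩ Z s ⁻¹' {i} ∩ Z t ⁻¹' {j}) = ENNReal.ofReal (p s t i j) * P (B ∩ Z s ⁻¹' {i}) := by
  have hle : history Z s ≤ mΩ := (history_le_fullHistory Z s).trans (fullHistory_le hZ.measurable)
  have hBi : MeasurableSet[history Z s] (B ∩ Z s ⁻¹' {i}) :=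
    MeasurableSet.inter hB (measurable_history hs le_rfl (measurableSet_singleton i))
  have hj : MeasurableSet (Z t ⁻¹' {j}) :=
    hZ.measurable t (hs.trans hst) (measurableSet_singleton j)
  have h1 : ∫ ω in B ∩ Z s ⁻¹' {i}, (Z t ⁻¹' {j}).indicator (fun _ => (1 : ℝ)) ω ∂P =
      ∫ ω in B ∩ Z s ⁻¹' {i}, p s t i j ∂P := by
    rw [← setIntegral_condExp hle ((integrable_const (1 : ℝ)).indicator hj) hBi]
    rw [setIntegral_congr_ae (hle _ hBi) ((hM.markov s t hs hst j).mono fun ω hω _ => hω)]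
    refine setIntegral_congr_fun (hle _ hBi) fun ω hω => ?_
    rw [show Z s ω = i from hω.2]
  rw [integral_indicator hj, setIntegral_const, setIntegral_const, smul_eq_mul, mul_one, smul_eq_mul] at h1
  rw [Measure.real, Measure.restrict_apply hj, Measure.real, inter_comm] at h1
  rw [← ENNReal.ofReal_toReal (measure_ne_top P (B ∩ Z s ⁻¹' {i} ∩ Z t ⁻¹' {j})), h1, mul_comm,
    ENNReal.ofReal_mul (hM.prob_nonneg s t hs hst i j), ENNReal.ofReal_toReal (measure_ne_top _ _)]

/-- Extra information independent of `Z` does not disturb the Markov property: on `A ∩ B` with `A`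
in `G` and `B` in the past of `Z`, the factor `P A` splits off on both sides. -/
theorem IsMarkovWithRates.measure_sup_history (hM : IsMarkovWithRates P Z p μ)
    (hZ : IsJumpProcess Z z₀) (hG : G ≤ mΩ) (hind : Indep G (fullHistory Z) P)
    {s t : ℝ} (hs : 0 ≤ s) (hst : s ≤ t) {C : Set Ω}
    (hC : MeasurableSet[G ⊔ history Z s] C) (i j : E) :
    P (C ∩ Z s ⁻¹' {i} ∩ Z t ⁻¹' {j}) = ENNReal.ofReal (p s t i j) * P (C ∩ Z s ⁻¹' {i}) := by
  have hle : history Z s ≤ mΩ := (history_le_fullHistory Z s).trans (fullHistory_le hZ.measurable)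
  have hi : MeasurableSet (Z s ⁻¹' {i}) := hZ.measurable s hs (measurableSet_singleton i)
  have hj : MeasurableSet (Z t ⁻¹' {j}) :=
    hZ.measurable t (hs.trans hst) (measurableSet_singleton j)
  have hi' : MeasurableSet[fullHistory Z] (Z s ⁻¹' {i}) := history_le_fullHistory Z s _
    (measurable_history hs le_rfl (measurableSet_singleton i))
  have hj' : MeasurableSet[fullHistory Z] (Z t ⁻¹' {j}) := history_le_fullHistory Z t _
    (measurable_history (hs.trans hst) le_rfl (measurableSet_singleton j))
  have hCm : MeasurableSet C := sup_le hG hle _ hC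
  have key := measure_eq_of_inter_eq (ν₁ := P.restrict (Z s ⁻¹' {i} ∩ Z t ⁻¹' {j}))
    (ν₂ := ENNReal.ofReal (p s t i j) • P.restrict (Z s ⁻¹' {i})) hG hle ?_ hC
  · rw [Measure.smul_apply, Measure.restrict_apply hCm, Measure.restrict_apply hCm,
      ← inter_assoc, smul_eq_mul] at key
    exact key
  · intro A B hA hB
    have hB' := history_le_fullHistory Z s _ hB
    have hAB : MeasurableSet (A ∩ B) := (hG _ hA).inter (hle _ hB)
    rw [Measure.smul_apply, Measure.restrict_apply hAB, Measure.restrict_apply hAB, smul_eq_mul,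
      inter_assoc, inter_assoc, ← inter_assoc B,
      Indep_iff _ _ _ |>.1 hind A _ hA (MeasurableSet.inter (MeasurableSet.inter hB' hi') hj'),
      Indep_iff _ _ _ |>.1 hind A _ hA (MeasurableSet.inter hB' hi'),
      hM.measure_history hZ hs hst hB]
    ring

/-- Kolmogorov's forward equation for the joint law of the information at time `u` and the state
at a later time. -/
theorem IsMarkovWithRates.forward_measure (hM : IsMarkovWithRates P Z p μ)
    (hZ : IsJumpProcess Z z₀) (hG : G ≤ mΩ) (hind : Indep G (fullHistory Z) P)
    {u v : ℝ} (hu : 0 ≤ u) (huv : u ≤ v) {C : Set Ω}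
    (hC : MeasurableSet[G ⊔ history Z u] C) {j k : E} (hjk : j ≠ k) :
    P.real (C ∩ Z u ⁻¹' {j} ∩ Z v ⁻¹' {k}) =
      ∫ w in u..v, ((∑ l ∈ Finset.univ.erase k,
          P.real (C ∩ Z u ⁻¹' {j} ∩ Z w ⁻¹' {l}) * μ l k w) -
        P.real (C ∩ Z u ⁻¹' {j} ∩ Z w ⁻¹' {k}) * ∑ l ∈ Finset.univ.erase k, μ k l w) := by
  have key : ∀ w l, u ≤ w → P.real (C ∩ Z u ⁻¹' {j} ∩ Z w ⁻¹' {l}) =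
      P.real (C ∩ Z u ⁻¹' {j}) * p u w j l := by
    intro w l huw
    rw [Measure.real, hM.measure_sup_history hZ hG hind hu huw hC, ENNReal.toReal_mul,
      ENNReal.toReal_ofReal (hM.prob_nonneg u w hu huw j l), mul_comm, Measure.real]
  -- The initial value in the forward equation vanishes because `j ≠ k`.
  rw [key v k huv, hM.forward u v hu huv, if_neg hjk, zero_add, ← intervalIntegral.integral_const_mul]
  refine intervalIntegral.integral_congr fun w hw => ?_
  rw [uIcc_of_le huv] at hw
  simp only [key w _ hw.1]
  rw [mul_sub, Finset.mul_sum]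
  simp only [mul_assoc]

end Compensator

/-! ### The compensator as the limit of expected grid counts. -/

section CompensatorLimit

variable {Ω E : Type*} {G : MeasurableSpace Ω} [mΩ : MeasurableSpace Ω] [MeasurableSpace E]
  {P : Measure Ω} {Z : ℝ → Ω → E} {z₀ : E} {p : ℝ → ℝ → E → E → ℝ} {μ : E → E → ℝ → ℝ}

/-- The joint probability of `C`, of `Z` being in `j` at the last grid point before `w`, and of `Z`
being in `l` at time `w`. -/
def gridProb (P : Measure Ω) (Z : ℝ → Ω → E) (C : Set Ω) (s h : ℝ) (j l : E) (w : ℝ) : ℝ :=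
  P.real (C ∩ Z (leftGrid s h w) ⁻¹' {j} ∩ Z w ⁻¹' {l})

theorem gridProb_nonneg {C : Set Ω} {s h : ℝ} (j l : E) (w : ℝ) :
    0 ≤ gridProb P Z C s h j l w := measureReal_nonneg

theorem gridProb_le_one [IsProbabilityMeasure P] {C : Set Ω} {s h : ℝ} (j l : E) (w : ℝ) :
    gridProb P Z C s h j l w ≤ 1 := measureReal_le_one

theorem IsMarkovWithRates.integrableOn_rate [Fintype E] [DecidableEq E] (hM : IsMarkovWithRates P Z p μ) {j k : E}
    (hjk : j ≠ k) {s n : ℝ} (hs : 0 ≤ s) (hsn : s ≤ n) : IntegrableOn (μ j k) (Ioc s n) :=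
  ((intervalIntegrable_iff_integrableOn_Ioc_of_le (hs.trans hsn)).1
    (hM.rate_integrable j k hjk n (hs.trans hsn))).mono_set (Ioc_subset_Ioc_left hs)

variable [MeasurableSingletonClass E] [IsProbabilityMeasure P]

theorem IsJumpProcess.aestronglyMeasurable_gridProb (hZ : IsJumpProcess Z z₀) {C : Set Ω}
    (hC : MeasurableSet C) {s h : ℝ} (hs : 0 ≤ s) (hh : 0 < h) (n : ℝ) (j l : E) :
    AEStronglyMeasurable (gridProb P Z C s h j l) (volume.restrict (Ioc s n)) := by
  let D : Set (Ω × ℝ) := {x | s < x.2 ∧ Z (leftGrid s h x.2) x.1 ∈ ({j} : Set E)} ∩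
    {x | 0 ≤ x.2 ∧ Z x.2 x.1 = l} ∩ C ×ˢ univ
  have hD : MeasurableSet D := by
    refine MeasurableSet.inter (MeasurableSet.inter ?_ (hZ.measurableSet_state l))
      (hC.prod MeasurableSet.univ)
    exact predictable_le (F := fun _ => mΩ) (fun _ => le_rfl) _
      (measurableSet_predictable_leftGrid monotone_const hZ.measurable hs hh
        (measurableSet_singleton j))
  have hm : Measurable fun w => (P ((fun ω => (ω, w)) ⁻¹' D)).toReal :=
    (measurable_measure_prodMk_right hD).ennreal_toReal
  refine ⟨_, hm.stronglyMeasurable, ?_⟩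
  filter_upwards [ae_restrict_mem measurableSet_Ioc] with w hw
  unfold gridProb Measure.real
  congr 2
  ext ω
  simp only [D, mem_inter_iff, mem_preimage, mem_singleton_iff, mem_ofPred_eq, mem_prod, mem_univ,
    and_true, hw.1, true_and, hs.trans hw.1.le]
  tauto

variable [Fintype E] [DecidableEq E]

/-- At almost every `w` there is almost surely no jump, so the state at the preceding grid point is
eventually the state at `w`, and two different states become incompatible. -/
theorem IsJumpProcess.tendsto_gridProb (hZ : IsJumpProcess Z z₀) {C : Set Ω}
    (hC : MeasurableSet C) {s : ℝ} (hs : 0 ≤ s) {h : ℕ → ℝ} (hpos : ∀ m, 0 < h m)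
    (hlim : Tendsto h atTop (𝓝 0)) (j l : E) :
    ∀ᵐ w ∂(volume : Measure ℝ), s < w →
      Tendsto (fun m => gridProb P Z C s (h m) j l w) atTop
        (𝓝 (if l = j then P.real (C ∩ Z w ⁻¹' {j}) else 0)) := by
  filter_upwards [hZ.ae_ae_leftState (P := P)] with w hw hsw
  have hw0 : 0 < w := hs.trans_lt hsw
  have hmeas : ∀ k, MeasurableSet (Z w ⁻¹' {k}) := fun k =>
    hZ.measurable w hw0.le (measurableSet_singleton k)
  have key : Tendsto (fun m => P (C ∩ Z (leftGrid s (h m) w) ⁻¹' {j} ∩ Z w ⁻¹' {l})) atTop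
      (𝓝 (P (C ∩ Z w ⁻¹' {j} ∩ Z w ⁻¹' {l}))) := by
    refine tendsto_measure_of_ae_tendsto_indicator_of_isFiniteMeasure atTop
      ((hC.inter (hmeas j)).inter (hmeas l)) (fun m => (hC.inter ?_).inter (hmeas l)) ?_
    · exact hZ.measurable _ (hs.trans (le_leftGrid (hpos m) hsw)) (measurableSet_singleton j)
    · filter_upwards [hw hw0] with ω hω
      filter_upwards [(hZ.leftState_iff hw0 (s := s) hpos hlim).1 hω] with m hm
      simp [hm]
  have key' := (ENNReal.tendsto_toReal (measure_ne_top P _)).comp key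
  suffices h : (if l = j then P.real (C ∩ Z w ⁻¹' {j}) else 0) =
      (P (C ∩ Z w ⁻¹' {j} ∩ Z w ⁻¹' {l})).toReal by rw [h]; exact key'
  split_ifs with hlj
  · subst hlj
    rw [inter_assoc, inter_self]; rfl
  · have : C ∩ Z w ⁻¹' {j} ∩ Z w ⁻¹' {l} = ∅ := by
      rw [eq_empty_iff_forall_notMem]
      rintro ω ⟨⟨_, h1⟩, h2⟩
      exact hlj (h2.symm.trans h1)
    simp [this]

/-- The expected rate of grid moves from `j` to `k` on the event `C`. -/
def gridRate (P : Measure Ω) (Z : ℝ → Ω → E) (μ : E → E → ℝ → ℝ) (C : Set Ω) (s h : ℝ) (j k : E)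
    (w : ℝ) : ℝ :=
  (∑ l ∈ Finset.univ.erase k, gridProb P Z C s h j l w * μ l k w) -
    gridProb P Z C s h j k w * ∑ l ∈ Finset.univ.erase k, μ k l w

/-- The total rate of the transitions into and out of the state `k`. -/
def rateBound (μ : E → E → ℝ → ℝ) (k : E) (w : ℝ) : ℝ :=
  (∑ l ∈ Finset.univ.erase k, |μ l k w|) + ∑ l ∈ Finset.univ.erase k, |μ k l w|

theorem IsMarkovWithRates.integrableOn_rateBound (hM : IsMarkovWithRates P Z p μ) (k : E)
    {s n : ℝ} (hs : 0 ≤ s) (hsn : s ≤ n) : IntegrableOn (rateBound μ k) (Ioc s n) := by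
  refine Integrable.add (integrable_finsetSum _ fun l hl => ?_)
    (integrable_finsetSum _ fun l hl => ?_)
  · exact (hM.integrableOn_rate (Finset.ne_of_mem_erase hl) hs hsn).abs
  · exact (hM.integrableOn_rate (Finset.ne_of_mem_erase hl).symm hs hsn).abs

theorem abs_gridRate_le {C : Set Ω} {s h : ℝ} (j k : E) (w : ℝ) :
    |gridRate P Z μ C s h j k w| ≤ rateBound μ k w := by
  have hb : ∀ l (x : ℝ), |gridProb P Z C s h j l w * x| ≤ |x| := fun l x => by
    rw [abs_mul, abs_of_nonneg (gridProb_nonneg j l w)]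
    exact mul_le_of_le_one_left (abs_nonneg x) (gridProb_le_one j l w)
  refine (abs_sub _ _).trans (add_le_add ?_ ?_)
  · exact (Finset.abs_sum_le_sum_abs _ _).trans (Finset.sum_le_sum fun l _ => hb l _)
  · exact (hb k _).trans (Finset.abs_sum_le_sum_abs _ _)

theorem IsMarkovWithRates.integrableOn_gridRate (hM : IsMarkovWithRates P Z p μ)
    (hZ : IsJumpProcess Z z₀) {C : Set Ω} (hC : MeasurableSet C) {s n h : ℝ} (hs : 0 ≤ s)
    (hsn : s ≤ n) (hh : 0 < h) (j k : E) :
    IntegrableOn (gridRate P Z μ C s h j k) (Ioc s n) := by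
  refine (hM.integrableOn_rateBound k hs hsn).mono' ?_
    (Eventually.of_forall fun w => abs_gridRate_le j k w)
  refine AEStronglyMeasurable.sub (Finset.aestronglyMeasurable_fun_sum _ fun l hl => ?_) ?_
  · exact (hZ.aestronglyMeasurable_gridProb hC hs hh n j l).mul
      (hM.integrableOn_rate (Finset.ne_of_mem_erase hl) hs hsn).aestronglyMeasurable
  · refine (hZ.aestronglyMeasurable_gridProb hC hs hh n j k).mul
      (Finset.aestronglyMeasurable_fun_sum _ fun l hl => ?_)
    exact (hM.integrableOn_rate (Finset.ne_of_mem_erase hl).symm hs hsn).aestronglyMeasurable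

/-- On the cell containing `w`, the point `leftGrid` is the left endpoint, so `gridRate` is the
integrand of the forward equation started there; the cells then add up to one integral. -/
theorem IsMarkovWithRates.setLIntegral_gridCount (hM : IsMarkovWithRates P Z p μ)
    (hZ : IsJumpProcess Z z₀) (hG : G ≤ mΩ) (hind : Indep G (fullHistory Z) P)
    {s n : ℝ} (hs : 0 ≤ s) (hsn : s < n) {C : Set Ω}
    (hC : MeasurableSet[G ⊔ history Z s] C) {j k : E} (hjk : j ≠ k) (m : ℕ) :
    ∫⁻ ω in C, gridCount Z s n j k m ω ∂P =
      ENNReal.ofReal (∫ w in Ioc s n, gridRate P Z μ C s ((n - s) / (m + 1)) j k w) := by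
  have hle : history Z s ≤ mΩ := (history_le_fullHistory Z s).trans (fullHistory_le hZ.measurable)
  have hCm : MeasurableSet C := sup_le hG hle _ hC
  have hh : 0 < (n - s) / ((m : ℝ) + 1) := div_pos (sub_pos.2 hsn) (by positivity)
  have hu0 : ∀ i, 0 ≤ gridPoint s n m i := fun i => hs.trans (le_gridPoint hsn.le m i)
  have hmeas : ∀ i l, MeasurableSet (Z (gridPoint s n m i) ⁻¹' {l}) := fun i l =>
    hZ.measurable _ (hu0 i) (measurableSet_singleton l)
  have hint := hM.integrableOn_gridRate (P := P) hZ hCm hs hsn.le hh j k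
  have hterm : ∀ i ∈ Finset.range (m + 1),
      P.real (C ∩ Z (gridPoint s n m i) ⁻¹' {j} ∩ Z (gridPoint s n m (i + 1)) ⁻¹' {k}) =
      ∫ w in (gridPoint s n m i)..(gridPoint s n m (i + 1)),
        gridRate P Z μ C s ((n - s) / (m + 1)) j k w := by
    intro i _
    have hmono := gridPoint_mono hsn.le m i.le_succ
    rw [hM.forward_measure hZ hG hind (hu0 i) hmono
      ((sup_le_sup_left (history_mono Z (le_gridPoint hsn.le m i)) G) _ hC) hjk,
      intervalIntegral.integral_of_le hmono, intervalIntegral.integral_of_le hmono]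
    refine setIntegral_congr_fun measurableSet_Ioc fun w hw => ?_
    have : leftGrid s ((n - s) / (m + 1)) w = gridPoint s n m i := leftGrid_eq hh hw
    simp only [gridRate, gridProb, this]
  have hsum : ∑ i ∈ Finset.range (m + 1),
      P.real (C ∩ Z (gridPoint s n m i) ⁻¹' {j} ∩ Z (gridPoint s n m (i + 1)) ⁻¹' {k}) =
      ∫ w in Ioc s n, gridRate P Z μ C s ((n - s) / (m + 1)) j k w := by
    rw [Finset.sum_congr rfl hterm, intervalIntegral.sum_integral_adjacent_intervals,
      gridPoint_zero, show gridPoint s n m (m + 1) = n from gridPoint_last s n m,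
      intervalIntegral.integral_of_le hsn.le]
    intro i hi
    rw [intervalIntegrable_iff_integrableOn_Ioc_of_le (gridPoint_mono hsn.le m i.le_succ)]
    refine hint.mono_set (Ioc_subset_Ioc (le_gridPoint hsn.le m i) ?_)
    calc gridPoint s n m (i + 1) ≤ gridPoint s n m (m + 1) := gridPoint_mono hsn.le m hi
      _ = n := gridPoint_last s n m
  rw [← hsum, ENNReal.ofReal_sum_of_nonneg fun _ _ => measureReal_nonneg]
  unfold gridCount
  rw [lintegral_finsetSum]
  · refine Finset.sum_congr rfl fun i _ => ?_
    rw [lintegral_indicator_one ((hmeas i j).inter (hmeas (i + 1) k)),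
      Measure.restrict_apply ((hmeas i j).inter (hmeas (i + 1) k)), ofReal_measureReal]
    congr 1
    rw [inter_comm, inter_assoc]
  · exact fun i _ => measurable_one.indicator ((hmeas i j).inter (hmeas (i + 1) k))

/-- Fatou's lemma, with a bound on the expected grid counts that does not depend on the mesh. This
has to precede the limit in `setLIntegral_jumpMeasure`, whose dominating function is the total
number of jumps. -/
theorem IsMarkovWithRates.lintegral_jumpMeasure_lt_top (hM : IsMarkovWithRates P Z p μ)
    (hZ : IsJumpProcess Z z₀) {s n : ℝ} (hs : 0 ≤ s) (hsn : s < n) {j k : E} (hjk : j ≠ k) :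
    ∫⁻ ω, jumpMeasure Z ω j k (Ioc s n) ∂P < ∞ := by
  have h1 : ∀ ω, jumpMeasure Z ω j k (Ioc s n) =
      liminf (fun m => gridCount Z s n j k m ω) atTop := fun ω =>
    (tendsto_nhds_of_eventually_eq (hZ.eventually_gridCount_eq ω hs hsn.le hjk)).liminf_eq.symm
  have h2 : ∀ m, ∫⁻ ω, gridCount Z s n j k m ω ∂P ≤
      ENNReal.ofReal (∫ w in Ioc s n, rateBound μ k w) := by
    intro m
    -- With the trivial σ-algebra as `G`, independence costs nothing.
    have := hM.setLIntegral_gridCount (P := P) (G := ⊥) hZ bot_le (indep_bot_left _) hs hsn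
      (C := univ) MeasurableSet.univ hjk m
    rw [setLIntegral_univ] at this
    rw [this]
    refine ENNReal.ofReal_le_ofReal (integral_mono
      (hM.integrableOn_gridRate hZ MeasurableSet.univ hs hsn.le
        (div_pos (sub_pos.2 hsn) (by positivity)) j k)
      (hM.integrableOn_rateBound k hs hsn.le) fun w => (le_abs_self _).trans (abs_gridRate_le j k w))
  calc ∫⁻ ω, jumpMeasure Z ω j k (Ioc s n) ∂P
      = ∫⁻ ω, liminf (fun m => gridCount Z s n j k m ω) atTop ∂P := lintegral_congr h1
    _ ≤ liminf (fun m => ∫⁻ ω, gridCount Z s n j k m ω ∂P) atTop :=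
        lintegral_liminf_le fun m => hZ.measurable_gridCount hs hsn.le j k m
    _ ≤ ENNReal.ofReal (∫ w in Ioc s n, rateBound μ k w) :=
        liminf_le_of_le (by isBoundedDefault) fun b hb => by
          obtain ⟨m, hm⟩ := hb.exists
          exact hm.trans (h2 m)
    _ < ∞ := ENNReal.ofReal_lt_top

/-- The compensator of the counting process of the jumps from `j` to `k`. -/
theorem IsMarkovWithRates.setLIntegral_jumpMeasure (hM : IsMarkovWithRates P Z p μ)
    (hZ : IsJumpProcess Z z₀) (hG : G ≤ mΩ) (hind : Indep G (fullHistory Z) P)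
    {s n : ℝ} (hs : 0 ≤ s) (hsn : s < n) {C : Set Ω}
    (hC : MeasurableSet[G ⊔ history Z s] C) {j k : E} (hjk : j ≠ k) :
    ∫⁻ ω in C, jumpMeasure Z ω j k (Ioc s n) ∂P =
      ∫⁻ w in Ioc s n, P (C ∩ Z w ⁻¹' {j}) * ENNReal.ofReal (μ j k w) := by
  have hle : history Z s ≤ mΩ := (history_le_fullHistory Z s).trans (fullHistory_le hZ.measurable)
  have hCm : MeasurableSet C := sup_le hG hle _ hC
  have hpos : ∀ m : ℕ, 0 < (n - s) / ((m : ℝ) + 1) := fun m =>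
    div_pos (sub_pos.2 hsn) (by positivity)
  have hlim : Tendsto (fun m : ℕ => (n - s) / ((m : ℝ) + 1)) atTop (𝓝 0) := by
    have := (tendsto_one_div_add_atTop_nhds_zero_nat (𝕜 := ℝ)).const_mul (n - s)
    simpa [div_eq_mul_inv] using this
  have hleft : Tendsto (fun m => ∫⁻ ω in C, gridCount Z s n j k m ω ∂P) atTop
      (𝓝 (∫⁻ ω in C, jumpMeasure Z ω j k (Ioc s n) ∂P)) := by
    refine tendsto_lintegral_of_dominated_convergence
      (fun ω => ∑ j, ∑ k ∈ Finset.univ.erase j, jumpMeasure Z ω j k (Ioc s n))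
      (fun m => hZ.measurable_gridCount hs hsn.le j k m)
      (fun m => Eventually.of_forall fun ω => hZ.gridCount_le ω hs hsn.le hjk m) ?_
      (Eventually.of_forall fun ω =>
        tendsto_nhds_of_eventually_eq (hZ.eventually_gridCount_eq ω hs hsn.le hjk))
    refine ne_of_lt (lt_of_le_of_lt (setLIntegral_le_lintegral _ _) ?_)
    have hmeas : ∀ j, ∀ k ∈ Finset.univ.erase j,
        Measurable fun ω => jumpMeasure Z ω j k (Ioc s n) := fun j k hk =>
      hZ.measurable_jumpMeasure_Ioc hs (Finset.ne_of_mem_erase hk).symm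
    rw [lintegral_finsetSum _ fun j _ => Finset.measurable_fun_sum _ (hmeas j)]
    refine ENNReal.sum_lt_top.2 fun j _ => ?_
    rw [lintegral_finsetSum _ (hmeas j)]
    exact ENNReal.sum_lt_top.2 fun k hk =>
      hM.lintegral_jumpMeasure_lt_top hZ hs hsn (Finset.ne_of_mem_erase hk).symm
  have hae : ∀ᵐ w ∂(volume.restrict (Ioc s n)), Tendsto (fun m : ℕ =>
      gridRate P Z μ C s ((n - s) / (m + 1)) j k w) atTop
      (𝓝 (P.real (C ∩ Z w ⁻¹' {j}) * μ j k w)) := by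
    have hall : ∀ᵐ w ∂(volume : Measure ℝ), ∀ l, s < w →
        Tendsto (fun m : ℕ => gridProb P Z C s ((n - s) / (m + 1)) j l w) atTop
          (𝓝 (if l = j then P.real (C ∩ Z w ⁻¹' {j}) else 0)) :=
      ae_all_iff.2 fun l => hZ.tendsto_gridProb hCm hs hpos hlim j l
    filter_upwards [ae_restrict_mem measurableSet_Ioc, ae_restrict_of_ae hall] with w hw hw'
    have h1 := (tendsto_finsetSum (Finset.univ.erase k) fun l _ =>
      (hw' l hw.1).mul_const (μ l k w)).sub
        ((hw' k hw.1).mul_const (∑ l ∈ Finset.univ.erase k, μ k l w))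
    refine (congrArg (fun x => Tendsto _ atTop (𝓝 x)) ?_).mp h1
    -- The outflow from `k` disappears in the limit, and of the inflow terms only `l = j` remains.
    rw [if_neg hjk.symm, zero_mul, sub_zero, Finset.sum_eq_single_of_mem j
      (Finset.mem_erase.2 ⟨hjk, Finset.mem_univ _⟩), if_pos rfl]
    intro l _ hl
    rw [if_neg hl, zero_mul]
  have hright : Tendsto (fun m : ℕ => ENNReal.ofReal
      (∫ w in Ioc s n, gridRate P Z μ C s ((n - s) / (m + 1)) j k w)) atTop
      (𝓝 (ENNReal.ofReal (∫ w in Ioc s n, P.real (C ∩ Z w ⁻¹' {j}) * μ j k w))) := by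
    refine ENNReal.tendsto_ofReal (tendsto_integral_of_dominated_convergence (rateBound μ k)
      (fun m => (hM.integrableOn_gridRate hZ hCm hs hsn.le (hpos m) j k).aestronglyMeasurable)
      (hM.integrableOn_rateBound k hs hsn.le)
      (fun m => Eventually.of_forall fun w => abs_gridRate_le j k w) hae)
  have heq := tendsto_nhds_unique hleft (hright.congr fun m =>
    (hM.setLIntegral_gridCount hZ hG hind hs hsn hC hjk m).symm)
  rw [heq, ofReal_integral_eq_lintegral_ofReal]
  · refine setLIntegral_congr_fun measurableSet_Ioc fun w _ => ?_
    rw [ENNReal.ofReal_mul measureReal_nonneg, ofReal_measureReal]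
  · refine (hM.integrableOn_rate hjk hs hsn.le).integrable.mono (aestronglyMeasurable_of_tendsto_ae atTop
      (fun m : ℕ => (hM.integrableOn_gridRate hZ hCm hs hsn.le (hpos m) j k).aestronglyMeasurable)
      hae) (Eventually.of_forall fun w => ?_)
    rw [norm_mul, Real.norm_of_nonneg measureReal_nonneg]
    exact mul_le_of_le_one_left (norm_nonneg _) measureReal_le_one
  · filter_upwards [ae_restrict_mem measurableSet_Ioc] with w hw
    exact mul_nonneg measureReal_nonneg (hM.rate_nonneg j k hjk w (hs.trans hw.1.le))

end CompensatorLimit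

/-! ### The filtration that knows `G` from the start. -/

section EnlargedHistory

variable {Ω E : Type*} [MeasurableSpace E] {G : MeasurableSpace Ω} {Z : ℝ → Ω → E}

/-- The information used for predictability: all of `G`, and the path of `Z` up to time `s`. -/
@[reducible] def enlargedHistory (G : MeasurableSpace Ω) (Z : ℝ → Ω → E) (s : ℝ) :
    MeasurableSpace Ω :=
  G ⊔ history Z s

theorem enlargedHistory_mono (G : MeasurableSpace Ω) (Z : ℝ → Ω → E) :
    Monotone (enlargedHistory G Z) := fun _ _ h => sup_le_sup_left (history_mono Z h) G

theorem IsJumpProcess.enlargedHistory_le [mΩ : MeasurableSpace Ω] {z₀ : E} (hZ : IsJumpProcess Z z₀) (hG : G ≤ mΩ) (s : ℝ) :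
    enlargedHistory G Z s ≤ mΩ :=
  sup_le hG ((history_le_fullHistory Z s).trans (fullHistory_le hZ.measurable))

end EnlargedHistory

/-! ### From the compensator on rectangles to predictable integrands. -/

section JumpKernel

/-- Cutting the parameter space by the integer part of the total mass gives countably many finite
kernels. The number of jumps is finite on each path but need not be bounded over paths. -/
theorem isSFiniteKernel_of_isFiniteMeasure {α β : Type*} [MeasurableSpace α] [MeasurableSpace β]
    (κ : Kernel α β) (h : ∀ a, IsFiniteMeasure (κ a)) : IsSFiniteKernel κ := by
  have hmeas : Measurable fun a => ⌊(κ a univ).toNNReal⌋₊ :=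
    (κ.measurable_coe MeasurableSet.univ).ennreal_toNNReal.nat_floor
  have hm : ∀ m : ℕ, MeasurableSet {a | ⌊(κ a univ).toNNReal⌋₊ = m} := fun m =>
    hmeas (measurableSet_singleton m)
  classical
  refine ⟨⟨fun m => Kernel.piecewise (hm m) κ 0, fun m => ?_, ?_⟩⟩
  · refine ⟨⟨(m : ℝ≥0∞) + 1, ENNReal.add_lt_top.2 ⟨ENNReal.natCast_lt_top m, ENNReal.one_lt_top⟩,
      fun a => ?_⟩⟩
    rw [Kernel.piecewise_apply']
    split_ifs with ha
    · rw [← ENNReal.coe_toNNReal (measure_ne_top (κ a) univ)]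
      have := Nat.lt_floor_add_one (κ a univ).toNNReal
      rw [show ⌊(κ a univ).toNNReal⌋₊ = m from ha] at this
      exact_mod_cast this.le
    · simp
  · ext a B hB
    rw [Kernel.sum_apply' _ _ hB, tsum_eq_single ⌊(κ a univ).toNNReal⌋₊]
    · rw [Kernel.piecewise_apply', if_pos]
      exact rfl
    · intro m hne
      rw [Kernel.piecewise_apply']
      split_ifs with h'
      · exact absurd (Eq.symm h') hne
      · simp

variable {Ω E : Type*} {G : MeasurableSpace Ω} [mΩ : MeasurableSpace Ω] [MeasurableSpace E]
  [MeasurableSingletonClass E] [DecidableEq E] {Z : ℝ → Ω → E} {z₀ : E}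

/-- The random measure `dN_{jk}` on `(0, n]`, `j ≠ k`, as a kernel. -/
def jumpKernel (hZ : IsJumpProcess Z z₀) (n : ℝ) (j k : E) : Kernel Ω ℝ where
  -- For `j = k`, `jumpMeasure` would count every positive time spent in `j` without a jump, so a
  -- default value is needed.
  toFun ω := if j = k then 0 else (jumpMeasure Z ω j k).restrict (Ioc 0 n)
  measurable' := by
    by_cases hjk : j = k
    · simp [hjk]
    simp only [if_neg hjk]
    have hinter : ∀ s : ℝ, Ioi s ∩ Ioc 0 n = Ioc (max s 0) n := fun s => by
      ext x; simp only [mem_inter_iff, mem_Ioi, mem_Ioc, sup_lt_iff]; tauto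
    have : ∀ ω, IsFiniteMeasure ((jumpMeasure Z ω j k).restrict (Ioc 0 n)) := fun ω =>
      ⟨by rw [Measure.restrict_apply_univ]; exact hZ.jumpMeasure_lt_top ω hjk 0 n⟩
    refine Measurable.measure_of_isPiSystem
      (BorelSpace.measurable_eq.trans (borel_eq_generateFrom_Ioi ℝ)) isPiSystem_Ioi ?_ ?_
    · rintro _ ⟨s, rfl⟩
      simp only [Measure.restrict_apply measurableSet_Ioi, hinter]
      exact hZ.measurable_jumpMeasure_Ioc (le_max_right _ _) hjk
    · simp only [Measure.restrict_apply_univ]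
      exact hZ.measurable_jumpMeasure_Ioc le_rfl hjk

theorem jumpKernel_apply (hZ : IsJumpProcess Z z₀) (n : ℝ) {j k : E} (hjk : j ≠ k) (ω : Ω) :
    jumpKernel hZ n j k ω = (jumpMeasure Z ω j k).restrict (Ioc 0 n) := if_neg hjk

instance isSFiniteKernel_jumpKernel (hZ : IsJumpProcess Z z₀) (n : ℝ) (j k : E) :
    IsSFiniteKernel (jumpKernel hZ n j k) := by
  refine isSFiniteKernel_of_isFiniteMeasure _ fun ω => ?_
  by_cases hjk : j = k
  · rw [show jumpKernel hZ n j k ω = 0 from if_pos hjk]; infer_instance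
  · rw [jumpKernel_apply hZ n hjk]
    exact ⟨by rw [Measure.restrict_apply_univ]; exact hZ.jumpMeasure_lt_top ω hjk 0 n⟩

variable [Fintype E] {P : Measure Ω} [IsProbabilityMeasure P]
  {p : ℝ → ℝ → E → E → ℝ} {μ : E → E → ℝ → ℝ}

/-- Two measures that agree on the generating rectangles agree on the predictable σ-algebra.
Predictability is essential: the set of jump times is Lebesgue null on every path, yet the left side
can charge it. -/
theorem IsMarkovWithRates.lintegral_jumpKernel (hM : IsMarkovWithRates P Z p μ)
    (hZ : IsJumpProcess Z z₀) (hG : G ≤ mΩ) (hind : Indep G (fullHistory Z) P)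
    {n : ℝ} (hn : 0 < n) {j k : E} (hjk : j ≠ k) {f : Ω × ℝ → ℝ≥0∞}
    (hf : Measurable[predictable (enlargedHistory G Z)] f) :
    ∫⁻ ω, ∫⁻ t, f (ω, t) ∂(jumpKernel hZ n j k ω) ∂P =
      ∫⁻ x, {x : Ω × ℝ | 0 ≤ x.2 ∧ Z x.2 x.1 = j}.indicator
        (fun x => ENNReal.ofReal (μ j k x.2)) x * f x ∂(P.prod (volume.restrict (Ioc 0 n))) := by
  have hple := predictable_le (hZ.enlargedHistory_le hG)
  set ρ : Ω × ℝ → ℝ≥0∞ := {x : Ω × ℝ | 0 ≤ x.2 ∧ Z x.2 x.1 = j}.indicator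
        (fun x => ENNReal.ofReal (μ j k x.2)) with hρ
  have hρm : AEMeasurable ρ (P.prod (volume.restrict (Ioc 0 n))) := by
    refine AEMeasurable.indicator ?_ (hZ.measurableSet_state j)
    exact (hM.integrableOn_rate hjk le_rfl
      hn.le).aestronglyMeasurable.aemeasurable.comp_snd.ennreal_ofReal
  set M₁ : Measure (Ω × ℝ) := P ⊗ₘ jumpKernel hZ n j k
  set M₂ : Measure (Ω × ℝ) := (P.prod (volume.restrict (Ioc 0 n))).withDensity ρ
  have hbasic : ∀ s, 0 ≤ s → ∀ C, MeasurableSet[enlargedHistory G Z s] C →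
      M₁ (C ×ˢ Ioi s) = M₂ (C ×ˢ Ioi s) := by
    intro s hs C hC
    have hCm : MeasurableSet C := hZ.enlargedHistory_le hG s _ hC
    have hinter : Ioi s ∩ Ioc 0 n = Ioc s n := by
      ext x; simp only [mem_inter_iff, mem_Ioi, mem_Ioc]
      exact ⟨fun h => ⟨h.1, h.2.2⟩, fun h => ⟨h.1, hs.trans_lt h.1, h.2⟩⟩
    have h1 : M₁ (C ×ˢ Ioi s) = ∫⁻ ω in C, jumpMeasure Z ω j k (Ioc s n) ∂P := by
      rw [Measure.compProd_apply_prod hCm measurableSet_Ioi]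
      simp only [jumpKernel_apply hZ n hjk, Measure.restrict_apply measurableSet_Ioi, hinter]
    have h2 : M₂ (C ×ˢ Ioi s) =
        ∫⁻ w in Ioc s n, P (C ∩ Z w ⁻¹' {j}) * ENNReal.ofReal (μ j k w) := by
      rw [withDensity_apply _ (hCm.prod measurableSet_Ioi), ← Measure.prod_restrict,
        Measure.restrict_restrict measurableSet_Ioi, hinter, lintegral_prod_symm]
      · refine setLIntegral_congr_fun measurableSet_Ioc fun w hw => ?_
        have hZw : MeasurableSet (Z w ⁻¹' {j}) :=
          hZ.measurable w (hs.trans hw.1.le) (measurableSet_singleton j)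
        have : ∀ ω, ρ (ω, w) = (Z w ⁻¹' {j}).indicator
            (fun _ => ENNReal.ofReal (μ j k w)) ω := fun ω => by
          by_cases h : Z w ω = j <;> simp [hρ, indicator, hs.trans hw.1.le, h]
        simp only [this]
        rw [lintegral_indicator hZw, setLIntegral_const, Measure.restrict_apply hZw, inter_comm,
          mul_comm]
      · refine hρm.mono_measure ?_
        exact Measure.prod_mono Measure.restrict_le_self
          (Measure.restrict_mono (Ioc_subset_Ioc_left hs) le_rfl)
    rw [h1, h2]
    rcases lt_or_ge s n with hsn | hsn
    · exact hM.setLIntegral_jumpMeasure hZ hG hind hs hsn hC hjk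
    · simp [Ioc_eq_empty hsn.not_gt]
  -- The whole space is not a generating rectangle, but both measures live on positive times, where
  -- `C = univ` and `s = 0` give the total mass.
  have huniv₁ : M₁ univ = M₁ (univ ×ˢ Ioi 0) := by
    rw [← univ_prod_univ, Measure.compProd_apply_prod MeasurableSet.univ MeasurableSet.univ,
      Measure.compProd_apply_prod MeasurableSet.univ measurableSet_Ioi]
    refine lintegral_congr fun ω => ?_
    rw [jumpKernel_apply hZ n hjk, Measure.restrict_apply_univ,
      Measure.restrict_apply measurableSet_Ioi, inter_eq_right.2 Ioc_subset_Ioi_self]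
  have huniv₂ : M₂ univ = M₂ (univ ×ˢ Ioi 0) := by
    rw [withDensity_apply _ MeasurableSet.univ,
      withDensity_apply _ (MeasurableSet.univ.prod measurableSet_Ioi), ← univ_prod_univ,
      ← Measure.prod_restrict, ← Measure.prod_restrict, Measure.restrict_univ,
      Measure.restrict_univ, Measure.restrict_restrict measurableSet_Ioi,
      inter_eq_right.2 Ioc_subset_Ioi_self]
  have hfin : M₁ univ < ∞ := by
    rw [huniv₁, Measure.compProd_apply_prod MeasurableSet.univ measurableSet_Ioi, setLIntegral_univ]
    simp only [jumpKernel_apply hZ n hjk, Measure.restrict_apply measurableSet_Ioi,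
      inter_eq_right.2 (Ioc_subset_Ioi_self : Ioc (0 : ℝ) n ⊆ Ioi 0)]
    exact hM.lintegral_jumpMeasure_lt_top hZ le_rfl hn hjk
  have : IsFiniteMeasure M₁ := ⟨hfin⟩
  have htrim : M₁.trim hple = M₂.trim hple := by
    refine ext_of_generate_finite _ rfl (isPiSystem_predictable (enlargedHistory_mono G Z)) ?_ ?_
    · rintro _ ⟨s, hs, C, hC, rfl⟩
      rw [trim_measurableSet_eq hple (measurableSet_predictable_Ioi hs hC),
        trim_measurableSet_eq hple (measurableSet_predictable_Ioi hs hC)]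
      exact hbasic s hs C hC
    · rw [trim_measurableSet_eq hple MeasurableSet.univ,
        trim_measurableSet_eq hple MeasurableSet.univ, huniv₁, huniv₂]
      exact hbasic 0 le_rfl univ MeasurableSet.univ
  have hf' : Measurable f := hf.mono hple le_rfl
  rw [← Measure.lintegral_compProd (f := f) hf', ← lintegral_trim hple hf]
  change ∫⁻ a, f a ∂(M₁.trim hple) = _
  rw [htrim, lintegral_trim hple hf, lintegral_withDensity_eq_lintegral_mul₀ hρm hf'.aemeasurable]
  rfl

end JumpKernel

/-! ### The payment stream as a kernel and its expected rate. -/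

section UnitBonus

variable {Ω E : Type*} {G : MeasurableSpace Ω} [mΩ : MeasurableSpace Ω] [MeasurableSpace E]
  [MeasurableSingletonClass E] {Z : ℝ → Ω → E} {z₀ : E}
  {P : Measure Ω} [IsProbabilityMeasure P] {p : ℝ → ℝ → E → E → ℝ} {μ : E → E → ℝ → ℝ}
  {b : E → ℝ → ℝ} {c : E → E → ℝ → ℝ}

/-- The payment `g` in the state `j = Z(t-)`, as a function of time and scenario. -/
def paymentIn (Z : ℝ → Ω → E) (j : E) (g : ℝ → ℝ) (ω : Ω) (t : ℝ) : ℝ≥0∞ :=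
  {x : Ω × ℝ | 0 < x.2 ∧ LeftState Z x.1 x.2 j}.indicator (fun x => ENNReal.ofReal (g x.2)) (ω, t)

theorem paymentIn_ne_top (Z : ℝ → Ω → E) (j : E) (g : ℝ → ℝ) (ω : Ω) (t : ℝ) :
    paymentIn Z j g ω t ≠ ∞ := by
  unfold paymentIn indicator
  split_ifs <;> simp

/-- Truncation at zero is needed because no generator meets the nonpositive times, so the
predictable σ-algebra cannot tell them apart. -/
theorem measurable_snd_predictable (F : ℝ → MeasurableSpace Ω) :
    Measurable[predictable F] fun x : Ω × ℝ => max x.2 0 := by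
  refine measurable_of_Ioi fun s => ?_
  rcases lt_or_ge s 0 with hs | hs
  · have : (fun x : Ω × ℝ => max x.2 0) ⁻¹' Ioi s = univ := by
      ext x; simp [hs]
    rw [this]; exact @MeasurableSet.univ _ (predictable F)
  · have : (fun x : Ω × ℝ => max x.2 0) ⁻¹' Ioi s = univ ×ˢ Ioi s := by
      ext x; simp [hs.not_gt]
    rw [this]; exact measurableSet_predictable_Ioi hs (@MeasurableSet.univ _ (F s))

theorem withDensity_leftState {ν : Measure ℝ} (hν : ∀ᵐ t ∂ν, 0 < t) (j : E) (g : ℝ → ℝ) (ω : Ω) :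
    ν.withDensity ({t | LeftState Z ω t j}.indicator fun t => ENNReal.ofReal (g t)) =
      ν.withDensity (paymentIn Z j g ω) := by
  refine withDensity_congr_ae ?_
  filter_upwards [hν] with t ht
  by_cases h : LeftState Z ω t j <;> simp [paymentIn, ht, h]

theorem IsJumpProcess.measurable_paymentIn (hZ : IsJumpProcess Z z₀)
    {F : ℝ → MeasurableSpace Ω} (hF : Monotone F) (hZF : ∀ t, 0 ≤ t → Measurable[F t] (Z t))
    (j : E) {g : ℝ → ℝ} (hg : Measurable g) :
    Measurable[predictable F] fun x : Ω × ℝ => paymentIn Z j g x.1 x.2 := by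
  have h1 : Measurable[predictable F] fun x : Ω × ℝ => ENNReal.ofReal (g (max x.2 0)) :=
    ENNReal.measurable_ofReal.comp (hg.comp (measurable_snd_predictable F))
  have h2 := h1.indicator (hZ.measurableSet_leftState hF hZF j)
  refine (congrArg (Measurable[predictable F]) (funext fun x => ?_)).mp h2
  unfold paymentIn
  by_cases hx : x ∈ {x : Ω × ℝ | 0 < x.2 ∧ LeftState Z x.1 x.2 j}
  · rw [indicator_of_mem hx, indicator_of_mem (s := {x : Ω × ℝ | _}) hx, max_eq_left hx.1.le]
  · rw [indicator_of_notMem hx, indicator_of_notMem (s := {x : Ω × ℝ | _}) hx]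

variable [Fintype E] [DecidableEq E]

/-- The unit bonus payment stream on `(0, n]`, as a kernel. -/
def bonusKernel (hZ : IsJumpProcess Z z₀) (b : E → ℝ → ℝ) (c : E → E → ℝ → ℝ) (n : ℝ) :
    Kernel Ω ℝ :=
  ∑ j, (Kernel.withDensity (Kernel.const Ω (volume.restrict (Ioc 0 n))) (paymentIn Z j (b j)) +
    ∑ k ∈ Finset.univ.erase j, Kernel.withDensity (jumpKernel hZ n j k) (paymentIn Z j (c j k)))

instance isSFiniteKernel_bonusKernel (hZ : IsJumpProcess Z z₀) (n : ℝ) :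
    IsSFiniteKernel (bonusKernel hZ b c n) := by
  refine Kernel.IsSFiniteKernel.finsetSum _ fun j _ => ?_
  have h1 := Kernel.IsSFiniteKernel.withDensity (Kernel.const Ω (volume.restrict (Ioc (0 : ℝ) n)))
    (paymentIn_ne_top Z j (b j))
  have h2 : IsSFiniteKernel (∑ k ∈ Finset.univ.erase j,
      Kernel.withDensity (jumpKernel hZ n j k) (paymentIn Z j (c j k))) :=
    Kernel.IsSFiniteKernel.finsetSum _ fun k _ =>
      Kernel.IsSFiniteKernel.withDensity _ (paymentIn_ne_top Z j (c j k))
  infer_instance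

theorem bonusKernel_apply (hZ : IsJumpProcess Z z₀) (hb : ∀ j, Measurable (b j))
    (hc : ∀ j k, j ≠ k → Measurable (c j k)) (n : ℝ) (ω : Ω) :
    bonusKernel hZ b c n ω = (unitBonus Z b c ω).restrict (Ioc 0 n) := by
  have hm : ∀ j (g : ℝ → ℝ), Measurable g → Measurable (Function.uncurry (paymentIn Z j g)) :=
    fun j g hg => (hZ.measurable_paymentIn (F := fun _ => mΩ) monotone_const hZ.measurable j
      hg).mono (predictable_le fun _ => le_rfl) le_rfl
  have hpos : ∀ ν : Measure ℝ, ∀ᵐ t ∂(ν.restrict (Ioc 0 n)), 0 < t := fun ν => by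
    filter_upwards [ae_restrict_mem measurableSet_Ioc] with t ht using ht.1
  unfold bonusKernel unitBonus
  conv_rhs => rw [← Measure.restrictₗ_apply, map_sum]
  rw [_root_.sum_apply]
  refine Finset.sum_congr rfl fun j _ => ?_
  rw [map_add, map_sum, _root_.add_apply, _root_.sum_apply,
    Kernel.withDensity_apply _ (hm j _ (hb j)), Kernel.const_apply, Measure.restrictₗ_apply,
    restrict_withDensity measurableSet_Ioc, Measure.restrict_restrict measurableSet_Ioc,
    inter_eq_left.2 (Ioc_subset_Ioi_self : Ioc (0 : ℝ) n ⊆ Ioi 0),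
    withDensity_leftState (hpos volume)]
  congr 1
  refine Finset.sum_congr rfl fun k hk => ?_
  have hjk := (Finset.ne_of_mem_erase hk).symm
  rw [Kernel.withDensity_apply _ (hm j _ (hc j k hjk)), Measure.restrictₗ_apply,
    restrict_withDensity measurableSet_Ioc, jumpKernel_apply hZ n hjk,
    withDensity_leftState (hpos (jumpMeasure Z ω j k))]

/-- The expected rate of unit bonus payments given the current state of the insured. -/
def bonusDensity (Z : ℝ → Ω → E) (μ : E → E → ℝ → ℝ) (b : E → ℝ → ℝ) (c : E → E → ℝ → ℝ)
    (x : Ω × ℝ) : ℝ≥0∞ :=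
  ∑ j, {x : Ω × ℝ | 0 ≤ x.2 ∧ Z x.2 x.1 = j}.indicator
    (fun x => ENNReal.ofReal (stateRate μ b c j x.2)) x

/-- The sojourn payments are already absolutely continuous; each transition payment is predictable,
so its counting measure may be replaced by the compensator. -/
theorem IsMarkovWithRates.lintegral_bonusKernel (hM : IsMarkovWithRates P Z p μ)
    (hZ : IsJumpProcess Z z₀) (hG : G ≤ mΩ) (hind : Indep G (fullHistory Z) P)
    {n : ℝ} (hn : 0 < n) (hb : ∀ j, Measurable (b j)) (hb0 : ∀ j t, 0 ≤ t → 0 ≤ b j t)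
    (hc : ∀ j k, j ≠ k → Measurable (c j k)) (hc0 : ∀ j k, j ≠ k → ∀ t, 0 ≤ t → 0 ≤ c j k t)
    {f : Ω × ℝ → ℝ≥0∞} (hf : Measurable[predictable (enlargedHistory G Z)] f) :
    ∫⁻ ω, ∫⁻ t, f (ω, t) ∂(bonusKernel hZ b c n ω) ∂P =
      ∫⁻ x, bonusDensity Z μ b c x * f x ∂(P.prod (volume.restrict (Ioc 0 n))) := by
  have hFZ : ∀ t, 0 ≤ t → Measurable[enlargedHistory G Z t] (Z t) := fun t ht =>
    (measurable_history ht le_rfl).mono le_sup_right le_rfl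
  have hpl := predictable_le (hZ.enlargedHistory_le hG)
  have hf' : Measurable f := hf.mono hpl le_rfl
  have hpay : ∀ j (g : ℝ → ℝ), Measurable g →
      Measurable[predictable (enlargedHistory G Z)] fun x : Ω × ℝ => paymentIn Z j g x.1 x.2 :=
    fun j g hg => hZ.measurable_paymentIn (enlargedHistory_mono G Z) hFZ j hg
  have hpay' : ∀ j (g : ℝ → ℝ), Measurable g →
      Measurable fun x : Ω × ℝ => paymentIn Z j g x.1 x.2 := fun j g hg =>
    (hpay j g hg).mono hpl le_rfl
  set ν := P.prod (volume.restrict (Ioc 0 n)) with hν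
  let S : E → Set (Ω × ℝ) := fun j => {x | 0 ≤ x.2 ∧ Z x.2 x.1 = j}
  have hS : ∀ j, MeasurableSet (S j) := fun j => hZ.measurableSet_state j
  let A : E → Ω × ℝ → ℝ≥0∞ := fun j x => paymentIn Z j (b j) x.1 x.2 * f x
  let B : E → E → Ω × ℝ → ℝ≥0∞ := fun j k x =>
    (S j).indicator (fun x => ENNReal.ofReal (μ j k x.2)) x * (paymentIn Z j (c j k) x.1 x.2 * f x)
  have hA : ∀ j, Measurable (A j) := fun j => (hpay' j _ (hb j)).mul hf'
  have hB : ∀ j k, j ≠ k → AEMeasurable (B j k) ν := fun j k hjk => by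
    refine AEMeasurable.mul (AEMeasurable.indicator ?_ (hS j))
      ((hpay' j _ (hc j k hjk)).mul hf').aemeasurable
    exact (hM.integrableOn_rate hjk le_rfl
      hn.le).aestronglyMeasurable.aemeasurable.comp_snd.ennreal_ofReal
  have hleft : ∫⁻ ω, ∫⁻ t, f (ω, t) ∂(bonusKernel hZ b c n ω) ∂P =
      ∑ j, (∫⁻ x, A j x ∂ν + ∑ k ∈ Finset.univ.erase j, ∫⁻ x, B j k x ∂ν) := by
    have h1 : ∀ ω, ∫⁻ t, f (ω, t) ∂(bonusKernel hZ b c n ω) =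
        ∑ j, ((∫⁻ t in Ioc 0 n, A j (ω, t)) + ∑ k ∈ Finset.univ.erase j,
          ∫⁻ t, paymentIn Z j (c j k) ω t * f (ω, t) ∂(jumpKernel hZ n j k ω)) := by
      intro ω
      have hfω : Measurable fun t => f (ω, t) := hf'.comp measurable_prodMk_left
      unfold bonusKernel
      rw [_root_.sum_apply, lintegral_finsetSum_measure]
      refine Finset.sum_congr rfl fun j _ => ?_
      rw [_root_.add_apply, lintegral_add_measure, _root_.sum_apply,
        lintegral_finsetSum_measure, Kernel.lintegral_withDensity _ (hpay' j _ (hb j)) ω hfω,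
        Kernel.const_apply]
      congr 1
      refine Finset.sum_congr rfl fun k hk => ?_
      exact Kernel.lintegral_withDensity _
        (hpay' j _ (hc j k (Finset.ne_of_mem_erase hk).symm)) ω hfω
    have hm1 : ∀ j, Measurable fun ω => ∫⁻ t in Ioc 0 n, A j (ω, t) := fun j =>
      (hA j).lintegral_prod_right'
    have hm2 : ∀ j, ∀ k ∈ Finset.univ.erase j, Measurable fun ω =>
        ∫⁻ t, paymentIn Z j (c j k) ω t * f (ω, t) ∂(jumpKernel hZ n j k ω) := fun j k hk =>
      Measurable.lintegral_kernel_prod_right'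
        ((hpay' j _ (hc j k (Finset.ne_of_mem_erase hk).symm)).mul hf')
    simp only [h1]
    rw [lintegral_finsetSum]
    swap
    · exact fun j _ => (hm1 j).add (Finset.measurable_fun_sum _ (hm2 j))
    refine Finset.sum_congr rfl fun j _ => ?_
    rw [lintegral_add_left (hm1 j), lintegral_finsetSum _ (hm2 j), hν,
      lintegral_prod _ (hA j).aemeasurable]
    congr 1
    refine Finset.sum_congr rfl fun k hk => ?_
    have hjk := (Finset.ne_of_mem_erase hk).symm
    exact hM.lintegral_jumpKernel hZ hG hind hn hjk ((hpay j _ (hc j k hjk)).mul hf)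
  -- Off a `P ⊗ dt` null set the left state is the current state, so the densities of all payments
  -- in state `j` combine into `stateRate`.
  have hright : ∀ᵐ x ∂ν, bonusDensity Z μ b c x * f x =
      ∑ j, (A j x + ∑ k ∈ Finset.univ.erase j, B j k x) := by
    filter_upwards [hZ.ae_leftState_iff (P := P) n] with x hx
    unfold bonusDensity
    rw [Finset.sum_mul]
    refine Finset.sum_congr rfl fun j _ => ?_
    by_cases hj : Z x.2 x.1 = j
    · have hxS : x ∈ S j := ⟨hx.1.le, hj⟩
      have hpj : ∀ g : ℝ → ℝ, paymentIn Z j g x.1 x.2 = ENNReal.ofReal (g x.2) := fun g =>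
        indicator_of_mem (s := {x : Ω × ℝ | 0 < x.2 ∧ LeftState Z x.1 x.2 j})
          ⟨hx.1, (hx.2 j).2 hj⟩ _
      have h0 : ∀ k ∈ Finset.univ.erase j, 0 ≤ c j k x.2 * μ j k x.2 := fun k hk =>
        mul_nonneg (hc0 j k (Finset.ne_of_mem_erase hk).symm _ hx.1.le)
          (hM.rate_nonneg j k (Finset.ne_of_mem_erase hk).symm _ hx.1.le)
      simp only [A, B, indicator_of_mem hxS, hpj]
      rw [indicator_of_mem (s := {x : Ω × ℝ | 0 ≤ x.2 ∧ Z x.2 x.1 = j}) hxS, stateRate,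
        ENNReal.ofReal_add (hb0 j _ hx.1.le) (Finset.sum_nonneg h0), add_mul,
        ENNReal.ofReal_sum_of_nonneg h0, Finset.sum_mul]
      congr 1
      refine Finset.sum_congr rfl fun k hk => ?_
      rw [ENNReal.ofReal_mul (hc0 j k (Finset.ne_of_mem_erase hk).symm _ hx.1.le)]
      ring
    · have hxS : x ∉ S j := fun h => hj h.2
      have hpj : ∀ g : ℝ → ℝ, paymentIn Z j g x.1 x.2 = 0 := fun g =>
        indicator_of_notMem (s := {x : Ω × ℝ | 0 < x.2 ∧ LeftState Z x.1 x.2 j})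
          (fun h => hj ((hx.2 j).1 h.2)) _
      rw [indicator_of_notMem (s := {x : Ω × ℝ | 0 ≤ x.2 ∧ Z x.2 x.1 = j}) hxS]
      simp [A, B, hpj]
  rw [hleft, lintegral_congr_ae hright, lintegral_finsetSum']
  swap
  · exact fun j _ => (hA j).aemeasurable.add (Finset.aemeasurable_fun_sum _ fun k hk =>
      hB j k (Finset.ne_of_mem_erase hk).symm)
  refine Finset.sum_congr rfl fun j _ => ?_
  rw [lintegral_add_left (hA j), lintegral_finsetSum' _ fun k hk =>
    hB j k (Finset.ne_of_mem_erase hk).symm]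

end UnitBonus

/-! ### Conditional expectations, independence and joint measurability. -/

section ConditionalExpectation

/-- Events of a `σ`-algebra `G ≥ G'` have the same conditional probability given `G'` and given
`G' ⊔ H` if `G` and `H` are independent. -/
theorem condExp_indicator_sup_of_indep {Ω : Type*} {G' G H : MeasurableSpace Ω}
    [mΩ : MeasurableSpace Ω] {P : Measure Ω} [IsProbabilityMeasure P] (hG' : G' ≤ G) (hG : G ≤ mΩ)
    (hH : H ≤ mΩ) (hind : Indep G H P) {A : Set Ω} (hA : MeasurableSet[G] A) :
    P[A.indicator (fun _ => (1 : ℝ)) | G'] =ᵐ[P] P[A.indicator (fun _ => (1 : ℝ)) | G' ⊔ H] := by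
  have hAm : MeasurableSet A := hG _ hA
  have hG'm : G' ≤ mΩ := hG'.trans hG
  have hle : G' ⊔ H ≤ mΩ := sup_le hG'm hH
  set a := P[A.indicator (fun _ => (1 : ℝ)) | G'] with ha
  have hint : Integrable (A.indicator fun _ => (1 : ℝ)) P := (integrable_const _).indicator hAm
  have ha0 : 0 ≤ᵐ[P] a := condExp_nonneg (Eventually.of_forall fun ω =>
    indicator_nonneg (fun _ _ => zero_le_one) ω)
  have hae : Measurable[G'] a := stronglyMeasurable_condExp.measurable
  have hasm : StronglyMeasurable[G' ⊔ H] a := stronglyMeasurable_condExp.mono le_sup_left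
  have key : ∀ C, MeasurableSet C → (∫⁻ ω in C, ENNReal.ofReal (a ω) ∂P) =
      ENNReal.ofReal (∫ ω in C, a ω ∂P) := fun C _ =>
    (ofReal_integral_eq_lintegral_ofReal integrable_condExp.integrableOn
      (ae_restrict_of_ae ha0)).symm
  -- It suffices to test on `A' ∩ B`, where independence factors `P B` out of both measures.
  have hmeas : ∀ C, MeasurableSet[G' ⊔ H] C → P.restrict A C =
      P.withDensity (fun ω => ENNReal.ofReal (a ω)) C := by
    intro C hC
    refine measure_eq_of_inter_eq hG'm hH (fun A' B hA' hB => ?_) hC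
    have hA'm := hG'm _ hA'
    have hBm := hH _ hB
    rw [Measure.restrict_apply (hA'm.inter hBm), withDensity_apply _ (hA'm.inter hBm),
      ← lintegral_indicator (hA'm.inter hBm)]
    have h1 : ∀ ω, (A' ∩ B).indicator (fun ω => ENNReal.ofReal (a ω)) ω =
        A'.indicator (fun ω => ENNReal.ofReal (a ω)) ω * B.indicator (fun _ => 1) ω := fun ω => by
      by_cases hω : ω ∈ A' <;> by_cases hω' : ω ∈ B <;> simp [hω, hω']
    have hmA : Measurable[G'] (A'.indicator fun ω => ENNReal.ofReal (a ω)) :=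
      (ENNReal.measurable_ofReal.comp hae).indicator hA'
    have hmB : Measurable[H] (B.indicator fun _ => (1 : ℝ≥0∞)) := measurable_const.indicator hB
    simp only [h1]
    rw [lintegral_mul_eq_lintegral_mul_lintegral_of_independent_measurableSpace hG'm hH
      (indep_of_indep_of_le_left hind hG')
      hmA hmB, lintegral_indicator hA'm, lintegral_indicator_const hBm, one_mul, key A' hA'm,
      setIntegral_condExp hG'm hint hA', integral_indicator hAm, setIntegral_const, smul_eq_mul,
      mul_one, measureReal_restrict_apply hAm, ofReal_measureReal,
      show A' ∩ B ∩ A = (A ∩ A') ∩ B by rw [inter_comm, ← inter_assoc]]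
    exact (Indep_iff _ _ _).1 hind _ _ (MeasurableSet.inter hA (hG' _ hA')) hB
  refine ae_eq_condExp_of_forall_setIntegral_eq hle hint
    (fun C _ _ => integrable_condExp.integrableOn) (fun C hC _ => ?_) hasm.aestronglyMeasurable
  have hCm := hle _ hC
  have h1 := hmeas C hC
  rw [withDensity_apply _ hCm, key C hCm, Measure.restrict_apply hCm] at h1
  rw [integral_indicator hAm, setIntegral_const, smul_eq_mul, mul_one, measureReal_restrict_apply hAm,
    Measure.real, inter_comm, h1, ENNReal.toReal_ofReal]
  exact integral_nonneg_of_ae (ae_restrict_of_ae ha0)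

/-- If `f` depends on `G' ≤ G` and on an independent `H` only, then the conditional expectations
of `f` given `G` and given `G'` agree. -/
theorem condExp_eq_condExp_of_indep {Ω : Type*} {G' G H : MeasurableSpace Ω}
    [mΩ : MeasurableSpace Ω] {P : Measure Ω} [IsProbabilityMeasure P] (hG' : G' ≤ G) (hG : G ≤ mΩ)
    (hH : H ≤ mΩ) (hind : Indep G H P) {f : Ω → ℝ} (hf : Integrable f P)
    (hfm : StronglyMeasurable[G' ⊔ H] f) : P[f | G'] =ᵐ[P] P[f | G] := by
  have hG'm : G' ≤ mΩ := hG'.trans hG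
  have hle : G' ⊔ H ≤ mΩ := sup_le hG'm hH
  refine ae_eq_condExp_of_forall_setIntegral_eq hG hf
    (fun A _ _ => integrable_condExp.integrableOn) (fun A hA _ => ?_)
    (stronglyMeasurable_condExp.mono hG').aestronglyMeasurable
  have hAm : MeasurableSet A := hG _ hA
  let e : Ω → ℝ := A.indicator fun _ => 1
  have he : Integrable e P := (integrable_const _).indicator hAm
  have hmul : ∀ (B : Set Ω) (g : Ω → ℝ), B.indicator (fun _ => (1 : ℝ)) * g = B.indicator g :=
    fun B g => by ext ω; by_cases h : ω ∈ B <;> simp [h]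
  have heg : ∀ g : Ω → ℝ, Integrable g P → Integrable (e * g) P := fun g hg => by
    rw [hmul]; exact hg.indicator hAm
  have hbdd : ∀ᵐ ω ∂P, ‖(P[e | G']) ω‖ ≤ 1 := by
    exact ae_bdd_abs_condExp_of_ae_bdd_abs (m := G') (μ := P) (R := (1 : ℝ)) (f := e)
      (Eventually.of_forall fun ω => by by_cases h : ω ∈ A <;> simp [e, h])
  -- The indicator `e` of `A` may be projected to `G' ⊔ H` when tested against `f`, and this
  -- projection already lies in `G'`; then `f` may be projected to `G'` as well. The integral of
  -- `P[f | G']` over `A` reduces to the same product.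
  have h1 : ∫ ω in A, f ω ∂P = ∫ ω, (P[e | G'] * P[f | G']) ω ∂P := by
    calc ∫ ω in A, f ω ∂P = ∫ ω, (e * f) ω ∂P := by rw [hmul, integral_indicator hAm]
      _ = ∫ ω, (P[e * f | G' ⊔ H]) ω ∂P := (integral_condExp hle).symm
      _ = ∫ ω, (P[e | G'] * f) ω ∂P := by
          refine integral_congr_ae ?_
          filter_upwards [condExp_mul_of_stronglyMeasurable_right hfm (heg f hf) he,
            condExp_indicator_sup_of_indep hG' hG hH hind hA] with ω h2 h3
          rw [h2, Pi.mul_apply, Pi.mul_apply, h3]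
      _ = ∫ ω, (P[P[e | G'] * f | G']) ω ∂P := (integral_condExp hG'm).symm
      _ = ∫ ω, (P[e | G'] * P[f | G']) ω ∂P := by
          refine integral_congr_ae (condExp_mul_of_stronglyMeasurable_left
            stronglyMeasurable_condExp ?_ hf)
          exact hf.bdd_mul (stronglyMeasurable_condExp.mono hG'm).aestronglyMeasurable hbdd
  rw [h1]
  calc ∫ ω in A, (P[f | G']) ω ∂P = ∫ ω, (e * P[f | G']) ω ∂P := by
        rw [hmul, integral_indicator hAm]
    _ = ∫ ω, (P[e * P[f | G'] | G']) ω ∂P := (integral_condExp hG'm).symm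
    _ = ∫ ω, (P[e | G'] * P[f | G']) ω ∂P :=
        integral_congr_ae (condExp_mul_of_stronglyMeasurable_right stronglyMeasurable_condExp
          (heg _ integrable_condExp) he)

/-- The conditional expectations of a process with right-continuous paths have a jointly
measurable version. -/
theorem exists_measurable_condExp_comap {Ω β : Type*} [MeasurableSpace Ω] [mβ : MeasurableSpace β]
    {P : Measure Ω} [IsFiniteMeasure P] {V : Ω → β} (hV : Measurable V) {X : ℝ → Ω → ℝ}
    (hX : ∀ t, 0 ≤ t → Measurable (X t)) (hXi : ∀ t, 0 ≤ t → Integrable (X t) P)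
    (hXc : ∀ᵐ ω ∂P, ∀ t, 0 ≤ t → Tendsto (fun s => X s ω) (𝓝[>] t) (𝓝 (X t ω))) :
    ∃ Y : ℝ≥0 × Ω → ℝ, Measurable Y ∧
      ∀ t : ℝ≥0, (fun ω => Y (t, ω)) =ᵐ[P] P[X t | mβ.comap V] := by
  -- The skeleton takes values in a standard Borel space, so a single regular conditional law serves
  -- all times; integrating `ofSkeleton` against it is jointly measurable.
  let κ : Kernel β (ℕ × ℕ → ℝ) := condDistrib (skeleton X) V P
  have hsk := measurable_skeleton hX
  refine ⟨fun x => ∫ y, ofSkeleton (x.1, y) ∂(κ (V x.2)), ?_, fun t => ?_⟩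
  · have h1 : StronglyMeasurable fun z : (ℝ≥0 × Ω) × (ℕ × ℕ → ℝ) => ofSkeleton (z.1.1, z.2) :=
      (measurable_ofSkeleton.comp ((measurable_fst.comp measurable_fst).prodMk
        measurable_snd)).stronglyMeasurable
    exact (h1.integral_kernel_prod_right' (κ := κ.comap (fun x : ℝ≥0 × Ω => V x.2)
      (hV.comp measurable_snd))).measurable
  · have h2 : (fun ω => ofSkeleton (t, skeleton X ω)) =ᵐ[P] X t :=
      hXc.mono fun ω hω => ofSkeleton_skeleton (hω t t.2)
    refine (condExp_ae_eq_integral_condDistrib hV hsk.aemeasurable (f := fun y => ofSkeleton (t, y))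
      (measurable_ofSkeleton.comp measurable_prodMk_left).stronglyMeasurable
      ((hXi t t.2).congr h2.symm)).symm.trans (condExp_congr_ae h2)

/-- A process `V` whose time marginals are conditional expectations of those of an integrable
process `W` is integrable, with the same integral. -/
theorem integrable_and_integral_eq_of_condExp {Ω T : Type*} [mΩ : MeasurableSpace Ω]
    [MeasurableSpace T] {P : Measure Ω} [IsFiniteMeasure P] {τ : Measure T} [SFinite τ]
    {G : T → MeasurableSpace Ω} {W V : Ω × T → ℝ} (hW : Integrable W (P.prod τ))
    (hV : AEStronglyMeasurable V (P.prod τ))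
    (hG : ∀ᵐ t ∂τ, G t ≤ mΩ)
    (h : ∀ᵐ t ∂τ, Integrable (fun ω => W (ω, t)) P →
      (fun ω => V (ω, t)) =ᵐ[P] P[fun ω => W (ω, t) | G t]) :
    Integrable V (P.prod τ) ∧ ∫ x, V x ∂(P.prod τ) = ∫ x, W x ∂(P.prod τ) := by
  have hWt := (integrable_prod_iff' hW.1).1 hW
  have h' : ∀ᵐ t ∂τ, (fun ω => V (ω, t)) =ᵐ[P] P[fun ω => W (ω, t) | G t] := by
    filter_upwards [h, hWt.1] with t ht ht' using ht ht'
  have hVi : Integrable V (P.prod τ) := by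
    rw [integrable_prod_iff' hV]
    refine ⟨h'.mono fun t ht => integrable_condExp.congr ht.symm, hWt.2.mono'
      hV.norm.prod_swap.integral_prod_right' ?_⟩
    -- Conditional expectation contracts the `L¹` norm at each time, so integrability of `W` over
    -- time passes to `V`.
    filter_upwards [h'] with t ht
    rw [Real.norm_of_nonneg (integral_nonneg fun _ => norm_nonneg _)]
    calc ∫ ω, ‖V (ω, t)‖ ∂P = ∫ ω, |(P[fun ω => W (ω, t) | G t]) ω| ∂P :=
          integral_congr_ae (ht.mono fun ω hω => by simp only [hω, Real.norm_eq_abs])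
      _ ≤ ∫ ω, ‖W (ω, t)‖ ∂P := integral_abs_condExp_le _
  refine ⟨hVi, ?_⟩
  rw [integral_prod_symm _ hVi, integral_prod_symm _ hW]
  refine integral_congr_ae ?_
  filter_upwards [h', hG] with t ht hGt
  rw [integral_congr_ae ht, integral_condExp hGt]

end ConditionalExpectation

/-! ### The discount factor. -/

section Discount

variable {Ω : Type*} {s₀ : ℝ} {r S₁ : ℝ → Ω → ℝ}

/-- The discount factor is `s₀ / S₀(t)`, hence read off from the market at time `t`, even if `r` is
not adapted. -/
theorem measurable_discount (hs₀ : 0 < s₀) {t : ℝ} (ht : 0 ≤ t) :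
    Measurable[history (market s₀ r S₁) t] (discount r t) := by
  have h1 : Measurable[history (market s₀ r S₁) t] (market s₀ r S₁ t) := measurable_history ht le_rfl
  have h2 : discount r t = fun ω => s₀ * ((market s₀ r S₁ t ω).1)⁻¹ := by
    ext ω
    rw [discount, market, bankAccount, mul_inv, mul_inv_cancel_left₀ hs₀.ne', Real.exp_neg]
  rw [h2]
  exact (measurable_fst.comp h1).inv.const_mul s₀

theorem continuousOn_discount {ω : Ω}
    (hr : ∀ t, 0 ≤ t → IntervalIntegrable (fun v => r v ω) volume 0 t) :
    ContinuousOn (fun t => discount r t ω) (Ici 0) := by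
  intro t ht
  have ht0 : (0 : ℝ) ≤ t := ht
  have h1 := intervalIntegral.continuousOn_primitive_interval' (hr (t + 1) (by linarith))
    (left_mem_uIcc)
  rw [uIcc_of_le (by linarith)] at h1
  have h2 : ContinuousWithinAt (fun t => ∫ v in (0 : ℝ)..t, r v ω) (Ici 0) t :=
    (h1 t ⟨ht0, by linarith⟩).mono_of_mem_nhdsWithin
      (inter_mem_nhdsWithin (Ici 0) (Iic_mem_nhds (lt_add_one t)))
  exact h2.neg.rexp

end Discount

/-! ### Replacing the payment stream by its expected rate, for signed integrands. -/

section Value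

variable {Ω E : Type*} {G : MeasurableSpace Ω} [mΩ : MeasurableSpace Ω] [MeasurableSpace E]
  [MeasurableSingletonClass E] [Fintype E] [DecidableEq E] {Z : ℝ → Ω → E} {z₀ : E}
  {P : Measure Ω} [IsProbabilityMeasure P] {p : ℝ → ℝ → E → E → ℝ} {μ : E → E → ℝ → ℝ}
  {b : E → ℝ → ℝ} {c : E → E → ℝ → ℝ}

theorem IsMarkovWithRates.aemeasurable_stateRate (hM : IsMarkovWithRates P Z p μ) {n : ℝ}
    (hn : 0 < n) (hb : ∀ j, Measurable (b j)) (hc : ∀ j k, j ≠ k → Measurable (c j k)) (j : E) :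
    AEMeasurable (stateRate μ b c j) (volume.restrict (Ioc 0 n)) := by
  refine (hb j).aemeasurable.add (Finset.aemeasurable_fun_sum _ fun k hk => ?_)
  have hjk := (Finset.ne_of_mem_erase hk).symm
  exact (hc j k hjk).aemeasurable.mul
    (hM.integrableOn_rate hjk le_rfl hn.le).aestronglyMeasurable.aemeasurable

theorem IsMarkovWithRates.aemeasurable_bonusDensity (hM : IsMarkovWithRates P Z p μ)
    (hZ : IsJumpProcess Z z₀) {n : ℝ} (hn : 0 < n) (hb : ∀ j, Measurable (b j))
    (hc : ∀ j k, j ≠ k → Measurable (c j k)) :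
    AEMeasurable (bonusDensity Z μ b c) (P.prod (volume.restrict (Ioc 0 n))) :=
  Finset.aemeasurable_fun_sum _ fun j _ =>
    (hM.aemeasurable_stateRate hn hb hc j).comp_snd.ennreal_ofReal.indicator
      (hZ.measurableSet_state j)

theorem bonusDensity_lt_top (Z : ℝ → Ω → E) (μ : E → E → ℝ → ℝ) (b : E → ℝ → ℝ)
    (c : E → E → ℝ → ℝ) (x : Ω × ℝ) : bonusDensity Z μ b c x < ∞ := by
  refine ENNReal.sum_lt_top.2 fun j _ => ?_
  unfold indicator
  split_ifs <;> simp

/-- Applied to indicators, `lintegral_bonusKernel` says that both measures have the same trim to the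
predictable σ-algebra; signed predictable integrands see only the trim. -/
theorem IsMarkovWithRates.integral_bonusKernel (hM : IsMarkovWithRates P Z p μ)
    (hZ : IsJumpProcess Z z₀) (hG : G ≤ mΩ) (hind : Indep G (fullHistory Z) P)
    {n : ℝ} (hn : 0 < n) (hb : ∀ j, Measurable (b j)) (hb0 : ∀ j t, 0 ≤ t → 0 ≤ b j t)
    (hc : ∀ j k, j ≠ k → Measurable (c j k)) (hc0 : ∀ j k, j ≠ k → ∀ t, 0 ≤ t → 0 ≤ c j k t)
    {Y : Ω × ℝ → ℝ} (hY : Measurable[predictable (enlargedHistory G Z)] Y)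
    (hYi : Integrable Y (P ⊗ₘ bonusKernel hZ b c n)) :
    Integrable (fun x => (bonusDensity Z μ b c x).toReal * Y x)
      (P.prod (volume.restrict (Ioc 0 n))) ∧
    ∫ x, Y x ∂(P ⊗ₘ bonusKernel hZ b c n) =
      ∫ x, (bonusDensity Z μ b c x).toReal * Y x ∂(P.prod (volume.restrict (Ioc 0 n))) := by
  have hple := predictable_le (hZ.enlargedHistory_le hG)
  have hρ := hM.aemeasurable_bonusDensity hZ hn hb hc
  set ν := P.prod (volume.restrict (Ioc 0 n))
  have hlt : ∀ᵐ x ∂ν, bonusDensity Z μ b c x < ∞ :=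
    Eventually.of_forall (bonusDensity_lt_top Z μ b c)
  have htrim : (P ⊗ₘ bonusKernel hZ b c n).trim hple =
      (ν.withDensity (bonusDensity Z μ b c)).trim hple := by
    refine @Measure.ext _ (predictable (enlargedHistory G Z)) _ _ fun R hR => ?_
    have hRm := hple _ hR
    have h1m : Measurable[predictable (enlargedHistory G Z)] (R.indicator fun _ => (1 : ℝ≥0∞)) :=
      measurable_const.indicator hR
    have h1 := hM.lintegral_bonusKernel hZ hG hind hn hb hb0 hc hc0 h1m
    rw [← Measure.lintegral_compProd (h1m.mono hple le_rfl), lintegral_indicator_const hRm,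
      one_mul] at h1
    rw [trim_measurableSet_eq hple hR, trim_measurableSet_eq hple hR, h1,
      withDensity_apply _ hRm, ← lintegral_indicator hRm]
    refine lintegral_congr fun x => ?_
    by_cases hx : x ∈ R <;> simp [hx]
  have hYs : StronglyMeasurable[predictable (enlargedHistory G Z)] Y := hY.stronglyMeasurable
  have hYi2 : Integrable Y (ν.withDensity (bonusDensity Z μ b c)) := by
    have := hYi.trim hple hYs
    rw [htrim] at this
    exact integrable_of_integrable_trim hple this
  refine ⟨(integrable_withDensity_iff_integrable_smul₀' hρ hlt).1 hYi2, ?_⟩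
  rw [integral_trim hple hYs, htrim, ← integral_trim hple hYs,
    integral_withDensity_eq_integral_toReal_smul₀ hρ hlt]
  rfl

theorem IsMarkovWithRates.bonusDensity_toReal (hM : IsMarkovWithRates P Z p μ)
    (hb0 : ∀ j t, 0 ≤ t → 0 ≤ b j t) (hc0 : ∀ j k, j ≠ k → ∀ t, 0 ≤ t → 0 ≤ c j k t)
    {x : Ω × ℝ} (hx : 0 ≤ x.2) :
    (bonusDensity Z μ b c x).toReal = stateRate μ b c (Z x.2 x.1) x.2 := by
  unfold bonusDensity
  rw [Finset.sum_eq_single_of_mem (Z x.2 x.1) (Finset.mem_univ _), indicator_of_mem,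
    ENNReal.toReal_ofReal]
  · refine add_nonneg (hb0 _ _ hx) (Finset.sum_nonneg fun k hk => ?_)
    have hjk := (Finset.ne_of_mem_erase hk).symm
    exact mul_nonneg (hc0 _ k hjk _ hx) (hM.rate_nonneg _ k hjk _ hx)
  · exact ⟨hx, rfl⟩
  · exact fun j _ hj => indicator_of_notMem (fun h => hj (Eq.symm h.2)) _

end Value

/-! ### Modified transition probabilities: existence and the market-adapted case. -/

section ModifiedProb

variable {Ω E β : Type*} [mΩ : MeasurableSpace Ω] [MeasurableSpace E] [MeasurableSpace β]
  [MeasurableSingletonClass E] {Z : ℝ → Ω → E} {z₀ : E}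
  {P : Measure Ω} [IsProbabilityMeasure P] {S : ℝ → Ω → β} {Q : ℝ → Ω → ℝ}

/-- Conditioning on the whole market history allows one kernel for all times; as the variable
depends on the market up to `t` and on the independent `Z`, the market's future adds nothing. -/
theorem exists_isModifiedProb (hZ : IsJumpProcess Z z₀) (hS : ∀ t, 0 ≤ t → Measurable (S t))
    (hind : Indep (fullHistory S) (fullHistory Z) P)
    (hQc : ∀ᵐ ω ∂P, ContinuousOn (fun t => Q t ω) (Ici 0))
    (hQa : ∀ t, 0 ≤ t → Measurable[history S t ⊔ history Z t] (Q t))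
    (hQi : ∀ t, 0 ≤ t → Integrable (Q t) P) :
    ∃ pQ : E → ℝ → Ω → ℝ, IsModifiedProb P (history S) Z Q pQ := by
  have hSle : fullHistory S ≤ mΩ := fullHistory_le hS
  have hZle : ∀ t, history Z t ≤ mΩ := fun t =>
    (history_le_fullHistory Z t).trans (fullHistory_le hZ.measurable)
  have hQm : ∀ t, 0 ≤ t → Measurable (Q t) := fun t ht => (hQa t ht).mono
    (sup_le ((history_le_fullHistory S t).trans hSle) (hZle t)) le_rfl
  have key : ∀ j, ∃ Y : ℝ≥0 × Ω → ℝ, Measurable Y ∧ ∀ t : ℝ≥0, (fun ω => Y (t, ω)) =ᵐ[P]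
      P[(Z t ⁻¹' {j}).indicator (Q t) | fullHistory S] := by
    intro j
    have hm : ∀ t, 0 ≤ t → MeasurableSet (Z t ⁻¹' {j}) := fun t ht =>
      hZ.measurable t ht (measurableSet_singleton j)
    -- The identity is viewed as a map into `Ω` with the σ-algebra `fullHistory S`, so that its
    -- comap is that σ-algebra.
    have h := @exists_measurable_condExp_comap Ω Ω mΩ (fullHistory S) P _ id
      (measurable_id'' hSle) (fun t => (Z t ⁻¹' {j}).indicator (Q t))
      (fun t ht => (hQm t ht).indicator (hm t ht)) (fun t ht => (hQi t ht).indicator (hm t ht)) ?_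
    · rwa [MeasurableSpace.comap_id] at h
    · filter_upwards [hQc] with ω hω t ht
      have h1 : Tendsto (fun s => Q s ω) (𝓝[>] t) (𝓝 (Q t ω)) :=
        (hω t ht).mono_left (nhdsWithin_mono _ (Ioi_subset_Ici ht))
      by_cases hj : Z t ω = j
      · rw [indicator_of_mem (show ω ∈ Z t ⁻¹' {j} from hj)]
        refine h1.congr' ((hZ.right_continuous ω t ht).mono fun s hs => ?_)
        exact (indicator_of_mem (show ω ∈ Z s ⁻¹' {j} from hs.trans hj) _).symm
      · rw [indicator_of_notMem (show ω ∉ Z t ⁻¹' {j} from hj)]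
        refine tendsto_nhds_of_eventually_eq ((hZ.right_continuous ω t ht).mono fun s hs => ?_)
        rw [indicator_of_notMem (show ω ∉ Z s ⁻¹' {j} from fun h => hj (hs.symm.trans h))]
  choose Y hYm hY using key
  refine ⟨fun j t ω => Y j (t.toNNReal, ω), ⟨fun j => ?_, fun j t ht => ?_⟩⟩
  · simpa only [Real.toNNReal_coe] using hYm j
  · have hj : MeasurableSet[history Z t] (Z t ⁻¹' {j}) :=
      measurable_history ht le_rfl (measurableSet_singleton j)
    have h1 := hY j t.toNNReal
    rw [Real.coe_toNNReal t ht] at h1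
    refine h1.trans (condExp_eq_condExp_of_indep (history_le_fullHistory S t) hSle (hZle t)
      (indep_of_indep_of_le_right hind (history_le_fullHistory Z t))
      ((hQi t ht).indicator (hZle t _ hj)) ?_).symm
    exact (hQa t ht).stronglyMeasurable.indicator ((le_sup_right : history Z t ≤ _) _ hj)

theorem IsModifiedProb.eq_mul_of_adapted [Fintype E] [DecidableEq E] {p : ℝ → ℝ → E → E → ℝ}
    {μ : E → E → ℝ → ℝ} {pQ : E → ℝ → Ω → ℝ} (hpQ : IsModifiedProb P (history S) Z Q pQ)
    (hM : IsMarkovWithRates P Z p μ) (hZ : IsJumpProcess Z z₀)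
    (hS : ∀ t, 0 ≤ t → Measurable (S t)) (hind : Indep (fullHistory S) (fullHistory Z) P)
    (hQi : ∀ t, 0 ≤ t → Integrable (Q t) P)
    (hQa : ∀ t, 0 ≤ t → Measurable[history S t] (Q t)) (j : E) {t : ℝ} (ht : 0 ≤ t) :
    pQ j t =ᵐ[P] fun ω => Q t ω * p 0 t z₀ j := by
  have hSle : history S t ≤ mΩ := (history_le_fullHistory S t).trans (fullHistory_le hS)
  have hZle : ∀ t, history Z t ≤ mΩ := fun t =>
    (history_le_fullHistory Z t).trans (fullHistory_le hZ.measurable)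
  have hj : MeasurableSet[history Z t] (Z t ⁻¹' {j}) :=
    measurable_history ht le_rfl (measurableSet_singleton j)
  have hjm : MeasurableSet (Z t ⁻¹' {j}) := hZle t _ hj
  let e : Ω → ℝ := (Z t ⁻¹' {j}).indicator fun _ => 1
  have he : Integrable e P := (integrable_const _).indicator hjm
  have hmul : (Z t ⁻¹' {j}).indicator (Q t) = Q t * e := by
    ext ω; by_cases h : ω ∈ Z t ⁻¹' {j} <;> simp [e, h]
  have h1 : P[(Z t ⁻¹' {j}).indicator (Q t) | history S t] =ᵐ[P]
      Q t * P[e | history S t] := by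
    rw [hmul]
    exact condExp_mul_of_stronglyMeasurable_left (hQa t ht).stronglyMeasurable
      (hmul ▸ (hQi t ht).indicator hjm) he
  have h2 : P[e | history S t] =ᵐ[P] fun _ => ∫ ω, e ω ∂P :=
    condExp_indep_eq (hZle t) hSle (stronglyMeasurable_const.indicator hj)
      (indep_of_indep_of_le_right (indep_of_indep_of_le_left hind (history_le_fullHistory S t))
        (history_le_fullHistory Z t)).symm
  -- The Markov property at time zero, where `Z` sits in `z₀`, gives the law of `Z t`.
  have h3 : ∫ ω, e ω ∂P = p 0 t z₀ j := by
    rw [← integral_condExp (hZle 0), integral_congr_ae (hM.markov 0 t le_rfl ht j)]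
    simp [hZ.init]
  filter_upwards [hpQ.condExp j t ht, h1, h2] with ω h4 h5 h6
  rw [h4, h5, Pi.mul_apply, h6, h3]

end ModifiedProb

end LifeBonus

end

/-! ### The valuation formula. -/

theorem mainTheorem2 {Ω E : Type*} [MeasurableSpace Ω] (P : Measure Ω) [IsProbabilityMeasure P]
    [Fintype E] [DecidableEq E] [MeasurableSpace E] [MeasurableSingletonClass E]
    -- financial market
    (s₀ : ℝ) (hs₀ : 0 < s₀) (r S₁ : ℝ → Ω → ℝ)
    (hr : ∀ᵐ ω ∂P, ∀ t, 0 ≤ t → IntervalIntegrable (fun v => r v ω) volume 0 t)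
    (hS : ∀ t, 0 ≤ t → Measurable (LifeBonus.market s₀ r S₁ t))
    -- state of the insured
    (Z : ℝ → Ω → E) (z₀ : E) (hZ : LifeBonus.IsJumpProcess Z z₀)
    (p : ℝ → ℝ → E → E → ℝ) (μ : E → E → ℝ → ℝ)
    (hMarkov : LifeBonus.IsMarkovWithRates P Z p μ)
    (hindep : Indep (LifeBonus.fullHistory (LifeBonus.market s₀ r S₁))
      (LifeBonus.fullHistory Z) P)
    -- unit bonus payments
    (n : ℝ) (hn : 0 < n) (b : E → ℝ → ℝ) (c : E → E → ℝ → ℝ)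
    (hb : ∀ j, Measurable (b j)) (hb0 : ∀ j t, 0 ≤ t → 0 ≤ b j t)
    (hc : ∀ j k, j ≠ k → Measurable (c j k)) (hc0 : ∀ j k, j ≠ k → ∀ t, 0 ≤ t → 0 ≤ c j k t)
    -- number of unit bonus payment streams
    (Q : ℝ → Ω → ℝ)
    (hQc : ∀ᵐ ω ∂P, ContinuousOn (fun t => Q t ω) (Ici 0))
    (hQa : ∀ t, 0 ≤ t →
      Measurable[LifeBonus.history (LifeBonus.market s₀ r S₁) t ⊔ LifeBonus.history Z t] (Q t))
    (hQi : ∀ t, 0 ≤ t → Integrable (Q t) P)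
    -- the bonus payments have an absolutely convergent value
    (hV : ∫⁻ ω, ∫⁻ t in Ioc 0 n,
      ‖LifeBonus.discount r t ω * Q t ω‖ₑ ∂(LifeBonus.unitBonus Z b c ω) ∂P < ∞) :
    (∃ pQ : E → ℝ → Ω → ℝ, LifeBonus.IsModifiedProb P
      (LifeBonus.history (LifeBonus.market s₀ r S₁)) Z Q pQ) ∧
    ∀ pQ : E → ℝ → Ω → ℝ, LifeBonus.IsModifiedProb P
      (LifeBonus.history (LifeBonus.market s₀ r S₁)) Z Q pQ →
      Integrable (fun ω => ∫ t in Ioc 0 n,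
        LifeBonus.discount r t ω * Q t ω ∂(LifeBonus.unitBonus Z b c ω)) P ∧
      Integrable (fun x : Ω × ℝ =>
        LifeBonus.discount r x.2 x.1 * LifeBonus.bonusCashFlow μ b c pQ x.2 x.1)
        (P.prod (volume.restrict (Ioc 0 n))) ∧
      LifeBonus.bonusValue P r Z b c Q n =
        ∫ ω, (∫ t in Ioc 0 n,
          LifeBonus.discount r t ω * LifeBonus.bonusCashFlow μ b c pQ t ω) ∂P ∧
      ((∀ t, 0 ≤ t → Measurable[LifeBonus.history (LifeBonus.market s₀ r S₁) t] (Q t)) →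
        (∀ j t, 0 ≤ t → pQ j t =ᵐ[P] fun ω => Q t ω * p 0 t z₀ j) ∧
        ∀ t, 0 ≤ t → LifeBonus.bonusCashFlow μ b c pQ t =ᵐ[P]
          fun ω => Q t ω * LifeBonus.unitCashFlow p μ b c z₀ 0 t) := by
  have hSle : LifeBonus.fullHistory (LifeBonus.market s₀ r S₁) ≤ ‹MeasurableSpace Ω› :=
    LifeBonus.fullHistory_le hS
  have hSt : ∀ t, LifeBonus.history (LifeBonus.market s₀ r S₁) t ≤ ‹MeasurableSpace Ω› := fun t =>
    (LifeBonus.history_le_fullHistory _ t).trans hSle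
  refine ⟨LifeBonus.exists_isModifiedProb hZ hS hindep hQc hQa hQi, fun pQ hpQ => ?_⟩
  have hDh : ∀ t, 0 ≤ t →
      Measurable[LifeBonus.history (LifeBonus.market s₀ r S₁) t] (LifeBonus.discount r t) :=
    fun t ht => LifeBonus.measurable_discount hs₀ ht
  have hHF : ∀ t, LifeBonus.history (LifeBonus.market s₀ r S₁) t ⊔ LifeBonus.history Z t ≤
      LifeBonus.enlargedHistory
      (LifeBonus.fullHistory (LifeBonus.market s₀ r S₁)) Z t := fun t =>
    sup_le_sup_right (LifeBonus.history_le_fullHistory _ t) _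
  have hDF : ∀ t, 0 ≤ t → Measurable[LifeBonus.enlargedHistory
      (LifeBonus.fullHistory (LifeBonus.market s₀ r S₁)) Z t] (LifeBonus.discount r t) :=
    fun t ht => (hDh t ht).mono (le_sup_left.trans (hHF t)) le_rfl
  have hQF : ∀ t, 0 ≤ t → Measurable[LifeBonus.enlargedHistory
      (LifeBonus.fullHistory (LifeBonus.market s₀ r S₁)) Z t] (Q t) :=
    fun t ht => (hQa t ht).mono (hHF t) le_rfl
  have hFmono := LifeBonus.enlargedHistory_mono
    (LifeBonus.fullHistory (LifeBonus.market s₀ r S₁)) Z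
  have hple := LifeBonus.predictable_le (hZ.enlargedHistory_le hSle)
  -- `Y` is the integrand for the compensator argument; the version `D` of the discount factor,
  -- obtained next, supplies joint measurability, since only continuity of almost every path is
  -- available.
  obtain ⟨Y, hYm, hY⟩ := LifeBonus.exists_predictable_of_continuousOn hFmono
    (X := fun t ω => LifeBonus.discount r t ω * Q t ω) fun t ht => (hDF t ht).mul (hQF t ht)
  obtain ⟨D, hDm, hD⟩ := LifeBonus.exists_predictable_of_continuousOn hFmono hDF
  have hDc : ∀ᵐ ω ∂P, ContinuousOn (fun t => LifeBonus.discount r t ω) (Ici 0) :=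
    hr.mono fun ω hω => LifeBonus.continuousOn_discount hω
  have hYX : ∀ᵐ ω ∂P, ∀ t, 0 < t → Y (ω, t) = LifeBonus.discount r t ω * Q t ω := by
    filter_upwards [hDc, hQc] with ω h1 h2 using hY ω (h1.mul h2)
  have hDD : ∀ᵐ ω ∂P, ∀ t, 0 < t → D (ω, t) = LifeBonus.discount r t ω :=
    hDc.mono fun ω h => hD ω h
  have hYm' : Measurable Y := hYm.mono hple le_rfl
  have hDm' : Measurable D := hDm.mono hple le_rfl
  have hker : ∀ᵐ ω ∂P, ∫ t in Ioc 0 n, LifeBonus.discount r t ω * Q t ω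
      ∂(LifeBonus.unitBonus Z b c ω) = ∫ t, Y (ω, t) ∂(LifeBonus.bonusKernel hZ b c n ω) := by
    filter_upwards [hYX] with ω hω
    rw [LifeBonus.bonusKernel_apply hZ hb hc]
    exact setIntegral_congr_fun measurableSet_Ioc fun t ht => (hω t ht.1).symm
  have hYi : Integrable Y (P ⊗ₘ LifeBonus.bonusKernel hZ b c n) := by
    refine ⟨hYm'.aestronglyMeasurable, ?_⟩
    rw [HasFiniteIntegral, Measure.lintegral_compProd hYm'.enorm]
    refine lt_of_eq_of_lt (lintegral_congr_ae ?_) hV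
    filter_upwards [hYX] with ω hω
    rw [LifeBonus.bonusKernel_apply hZ hb hc]
    exact setLIntegral_congr_fun measurableSet_Ioc fun t ht => by rw [hω t ht.1]
  obtain ⟨hρY, hval⟩ := hMarkov.integral_bonusKernel hZ hSle hindep hn hb hb0 hc hc0 hYm hYi
  set ν := P.prod (volume.restrict (Ioc 0 n)) with hν
  -- `W j` is the part of the compensated integrand with the insured in state `j`, and `V j` its
  -- conditional expectation given the market up to each time.
  let W : E → Ω × ℝ → ℝ := fun j => {x : Ω × ℝ | 0 ≤ x.2 ∧ Z x.2 x.1 = j}.indicator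
    fun x => (LifeBonus.bonusDensity Z μ b c x).toReal * Y x
  let V : E → Ω × ℝ → ℝ := fun j x =>
    LifeBonus.stateRate μ b c j x.2 * (LifeBonus.discount r x.2 x.1 * pQ j x.2 x.1)
  have hsnd : ∀ᵐ x ∂ν, x.2 ∈ Ioc 0 n :=
    Measure.quasiMeasurePreserving_snd.ae (ae_restrict_mem measurableSet_Ioc)
  have hWi : ∀ j, Integrable (W j) ν := fun j => hρY.indicator (hZ.measurableSet_state j)
  have hWsum : ∀ᵐ x ∂ν, (LifeBonus.bonusDensity Z μ b c x).toReal * Y x = ∑ j, W j x := by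
    filter_upwards [hsnd] with x hx
    rw [Finset.sum_eq_single_of_mem (Z x.2 x.1) (Finset.mem_univ _)]
    · have hmem : x ∈ {y : Ω × ℝ | 0 ≤ y.2 ∧ Z y.2 y.1 = Z x.2 x.1} := ⟨hx.1.le, rfl⟩
      simp only [W, indicator_of_mem hmem]
    · exact fun j _ hj => indicator_of_notMem
        (s := {y : Ω × ℝ | 0 ≤ y.2 ∧ Z y.2 y.1 = j}) (fun h => hj (Eq.symm h.2)) _
  have hVm : ∀ j, AEStronglyMeasurable (V j) ν := by
    intro j
    refine AEStronglyMeasurable.mul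
      (hMarkov.aemeasurable_stateRate hn hb hc j).comp_snd.aestronglyMeasurable ?_
    -- Joint measurability of `pQ` is only given on nonnegative times, so time passes through `ℝ≥0`.
    have hp : Measurable fun x : Ω × ℝ => pQ j (x.2.toNNReal : ℝ) x.1 :=
      (hpQ.measurable j).comp (measurable_snd.real_toNNReal.prodMk measurable_fst)
    refine ⟨fun x => D x * pQ j (x.2.toNNReal : ℝ) x.1, (hDm'.mul hp).stronglyMeasurable, ?_⟩
    filter_upwards [hsnd, Measure.quasiMeasurePreserving_fst.ae hDD] with x hx hx'
    rw [hx' x.2 hx.1, Real.coe_toNNReal _ hx.1.le]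
  have hslice : ∀ j, ∀ᵐ t ∂(volume.restrict (Ioc 0 n)), Integrable (fun ω => W j (ω, t)) P →
      (fun ω => V j (ω, t)) =ᵐ[P]
        P[fun ω => W j (ω, t) | LifeBonus.history (LifeBonus.market s₀ r S₁) t] := by
    intro j
    filter_upwards [ae_restrict_mem measurableSet_Ioc] with t ht hint
    have hZt : MeasurableSet (Z t ⁻¹' {j}) :=
      hZ.measurable t ht.1.le (measurableSet_singleton j)
    let f : Ω → ℝ := fun ω => LifeBonus.stateRate μ b c j t * LifeBonus.discount r t ω
    have hWt : (fun ω => W j (ω, t)) =ᵐ[P] f * (Z t ⁻¹' {j}).indicator (Q t) := by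
      filter_upwards [hYX] with ω hω
      by_cases hj : Z t ω = j
      · rw [Pi.mul_apply, indicator_of_mem (show ω ∈ Z t ⁻¹' {j} from hj)]
        refine (indicator_of_mem (s := {y : Ω × ℝ | 0 ≤ y.2 ∧ Z y.2 y.1 = j})
          ⟨ht.1.le, hj⟩ _).trans ?_
        rw [hMarkov.bonusDensity_toReal hb0 hc0 ht.1.le, hω t ht.1]
        simp only [hj, f]
        ring
      · rw [Pi.mul_apply, indicator_of_notMem (show ω ∉ Z t ⁻¹' {j} from hj), mul_zero]
        exact indicator_of_notMem (fun h => hj h.2) _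
    have hfm : StronglyMeasurable[LifeBonus.history (LifeBonus.market s₀ r S₁) t] f :=
      ((hDh t ht.1.le).const_mul _).stronglyMeasurable
    -- The factor `f` is known to the market at time `t` and comes out, leaving the definition of
    -- the modified probability.
    have h1 := condExp_mul_of_stronglyMeasurable_left hfm (hint.congr hWt)
      ((hQi t ht.1.le).indicator hZt)
    filter_upwards [condExp_congr_ae hWt, h1, hpQ.condExp j t ht.1.le] with ω h2 h3 h4
    rw [h2, h3, Pi.mul_apply, ← h4]
    simp only [V, f]
    ring
  have hVW : ∀ j, Integrable (V j) ν ∧ ∫ x, V j x ∂ν = ∫ x, W j x ∂ν := fun j =>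
    LifeBonus.integrable_and_integral_eq_of_condExp (hWi j) (hVm j)
      (Eventually.of_forall fun t => hSt t) (hslice j)
  have hVsum : (fun x : Ω × ℝ => LifeBonus.discount r x.2 x.1 *
      LifeBonus.bonusCashFlow μ b c pQ x.2 x.1) = fun x => ∑ j, V j x := by
    ext x
    rw [LifeBonus.bonusCashFlow, Finset.mul_sum]
    refine Finset.sum_congr rfl fun j _ => ?_
    simp only [V]
    ring
  have hVint : Integrable (fun x : Ω × ℝ => LifeBonus.discount r x.2 x.1 *
      LifeBonus.bonusCashFlow μ b c pQ x.2 x.1) ν := by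
    rw [hVsum]
    exact integrable_finsetSum _ fun j _ => (hVW j).1
  refine ⟨?_, hVint, ?_, fun hQS => ?_⟩
  · refine Integrable.congr ?_ (hker.mono fun ω h => h.symm)
    exact MeasureTheory.Integrable.integral_compProd hYi
  · calc LifeBonus.bonusValue P r Z b c Q n
        = ∫ ω, ∫ t, Y (ω, t) ∂(LifeBonus.bonusKernel hZ b c n ω) ∂P := integral_congr_ae hker
      _ = ∫ x, Y x ∂(P ⊗ₘ LifeBonus.bonusKernel hZ b c n) := (Measure.integral_compProd hYi).symm
      _ = ∫ x, ∑ j, W j x ∂ν := hval.trans (integral_congr_ae hWsum)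
      _ = ∫ x, ∑ j, V j x ∂ν := by
          rw [integral_finsetSum _ fun j _ => hWi j, integral_finsetSum _ fun j _ => (hVW j).1]
          exact Finset.sum_congr rfl fun j _ => (hVW j).2.symm
      _ = _ := by rw [← hVsum, integral_prod _ hVint]
  · have hadj := fun j t (ht : 0 ≤ t) => hpQ.eq_mul_of_adapted hMarkov hZ hS hindep hQi hQS j ht
    refine ⟨hadj, fun t ht => ?_⟩
    filter_upwards [ae_all_iff.2 fun j => hadj j t ht] with ω hω
    rw [LifeBonus.bonusCashFlow, LifeBonus.unitCashFlow, Finset.mul_sum]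
    refine Finset.sum_congr rfl fun j _ => ?_
    rw [hω j, mul_assoc]
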